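/- Let $A=(b_n)_{n\ge 1}$ be a sequence of integers $b_n\ge 2$. Assume that for every $k$ the limit $d_k=\lim_{n\to\infty}\frac1n\,\mathrm{card}\{1\le i\le n: b_i=k\}$ exists, that $\sum_{n\ge 2}d_n=1$, that $\sum_{n\ge2}d_n\log n<\infty$, and that $\lim_{n\to\infty}\frac1n\sum_{i=1}^n\log b_i=\sum_{n\ge 2}d_n\log n$. Let $\alpha=(\alpha_j)_{j\ge0}$ be a stochastic vector, i.e. $\alpha_j\ge0$ and $\sum_{j\ge0}\alpha_j=1$. Let $J_A(\alpha)$ be the set of all $x\in[0,1]$ having a Cantor series expansion $x=\sum_{n\ge1}\frac{\epsilon_n}{b_1b_2\cdots b_n}$, $\epsilon_n\in\{0,\dots,b_n-1\}$ (unique except for countably many $x$), such that $\lim_{n\to\infty}\frac1n\,\mathrm{card}\{1\le k\le n:\epsilon_k=j\}=\alpha_j$ for every $j\ge0$. Assume that $\alpha$ is compatible with $d$: there are numbers $p_{n,j}\ge0$ ($n\ge2$, $0\le j<n$) with $\sum_{j=0}^{n-1}p_{n,j}=1$ for every $n\ge 2$ and $\sum_{n\ge 2,\;n>j}d_np_{n,j}=\alpha_j$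 for every $j\ge 0$. Put $j_0=\min\{j:\alpha_j\ne0\}$, $d_1=0$ and $$A_n=\sum_{j=j_0}^{n-1}\alpha_j-\sum_{k=j_0+1}^{n-1}d_k,\qquad r_n=\frac1{A_n}\prod_{k=j_0+1}^{n-1}\Big(1-\frac{d_k}{A_k}\Big),\qquad t_j=\frac{\alpha_j}{\prod_{k=j_0+1}^{j}\big(1-\frac{d_k}{A_k}\big)}.$$ Assume that $t_j$ is defined whenever $\alpha_j\neq0$, i.e. that $A_k\ne0$ and $A_k\ne d_k$ whenever $j_0<k\le j$ and $\alpha_j\ne0$, and that the series $\sum_{j\ge j_0}\alpha_j\log t_j$ converges, where terms with $\alpha_j=0$ are read as $0$. Then the series $\sum_{i\ge j_0+1}d_i\log r_i$ (terms with $d_i=0$ are read as $0$) also converges, and $$\dim_H J_A(\alpha)=-\,\frac{\sum_{j=j_0}^{\infty}\alpha_j\log t_j+\sum_{i=j_0+1}^{\infty}d_i\log r_i}{\sum_{n=2}^{\infty}d_n\log n}.$$ -/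

import Mathlib

open Filter Topology

noncomputable section

namespace CantorSeries

/-- `D_k(n)`: the number of `k`'s among the first `n` bases. The sequence `b_1, b_2, …` is indexed
from `0` in the code, so `b i` stands for `b_{i+1}`. -/
def baseCount (b : ℕ → ℕ) (k n : ℕ) : ℕ :=
  ((Finset.range n).filter (fun i => b i = k)).card

/-- `d_k = lim D_k(n) / n` for every `k` (in particular, all these limits exist). -/
def IsBaseFrequency (b : ℕ → ℕ) (d : ℕ → ℝ) : Prop :=
  ∀ k, Tendsto (fun n : ℕ => (baseCount b k n : ℝ) / n) atTop (𝓝 (d k))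

/-- `ε` is a sequence of digits of the Cantor series of `x` with respect to the base `b`. -/
def IsExpansion (b : ℕ → ℕ) (ε : ℕ → ℕ) (x : ℝ) : Prop :=
  (∀ i, ε i < b i) ∧
    HasSum (fun i => (ε i : ℝ) / ∏ k ∈ Finset.range (i + 1), (b k : ℝ)) x

/-- `τ_j(x, n)`: the number of `j`'s among the first `n` digits. -/
def digitCount (ε : ℕ → ℕ) (j n : ℕ) : ℕ :=
  ((Finset.range n).filter (fun i => ε i = j)).card

/-- `J_A(α)`: the points of `[0,1]` in whose Cantor series every digit `j` has frequency `α j`.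
The countably many points with two expansions are included when one of the two qualifies. -/
def levelSet (b : ℕ → ℕ) (α : ℕ → ℝ) : Set ℝ :=
  {x | x ∈ Set.Icc (0 : ℝ) 1 ∧ ∃ ε : ℕ → ℕ, IsExpansion b ε x ∧
    ∀ j, Tendsto (fun n : ℕ => (digitCount ε j n : ℝ) / n) atTop (𝓝 (α j))}

/-- A stochastic vector indexed by `0, 1, 2, …`. -/
def IsStochastic (α : ℕ → ℝ) : Prop :=
  (∀ j, 0 ≤ α j) ∧ HasSum α 1

/-- The arrays `p n j`, `n ≥ 2`, `0 ≤ j < n`, whose rows are probability vectors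
(extended by `0` to `j ≥ n`; the rows `n = 0, 1` play no role). -/
def tables : Set (ℕ → ℕ → ℝ) :=
  {p | ∀ n, 2 ≤ n →
    (∀ j, 0 ≤ p n j) ∧ (∀ j, n ≤ j → p n j = 0) ∧ ∑ j ∈ Finset.range n, p n j = 1}

/-- `π(α)`: the arrays with `α_j = ∑_n d_n p_{n,j}` for every `j`. -/
def tablesWith (d α : ℕ → ℝ) : Set (ℕ → ℕ → ℝ) :=
  {p | p ∈ tables ∧ ∀ j, HasSum (fun n => d n * p n j) (α j)}

/-- `j₀ = min {j : α_j ≠ 0}`. -/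
def firstIndex (α : ℕ → ℝ) : ℕ := sInf {j | α j ≠ 0}

/-- `A_n = ∑_{j=j₀}^{n-1} α_j - ∑_{k=j₀+1}^{n-1} d_k`. -/
def seqA (d α : ℕ → ℝ) (n : ℕ) : ℝ :=
  ∑ j ∈ Finset.Ico (firstIndex α) n, α j - ∑ k ∈ Finset.Ico (firstIndex α + 1) n, d k

/-- `r_n = (1 / A_n) ∏_{k=j₀+1}^{n-1} (1 - d_k / A_k)`. -/
def seqR (d α : ℕ → ℝ) (n : ℕ) : ℝ :=
  1 / seqA d α n * ∏ k ∈ Finset.Ico (firstIndex α + 1) n, (1 - d k / seqA d α k)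

/-- `t_j = α_j / ∏_{k=j₀+1}^{j} (1 - d_k / A_k)`. -/
def seqT (d α : ℕ → ℝ) (j : ℕ) : ℝ :=
  α j / ∏ k ∈ Finset.Icc (firstIndex α + 1) j, (1 - d k / seqA d α k)

end CantorSeries

end

/-! Write `L` for the mean of `log b_i`. Every compatible table `p` gives a lower bound. Choose the
digits independently, the digit in base `k` with law `p k`. The law of large numbers gives the pairs
(base, digit) the frequencies `d k * p k j`, hence the digits the frequencies `α j`. A cylinder of
length `n` then typically has mass about `exp (-n h)`, with `h = ∑ d k * rowEntropy p k`, and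
diameter about `exp (-n L)`. Mass distribution yields dimension at least `h / L`
(`le_dimH_levelSet_of_lt_entropy`).

The table that attains the dimension has product form `p n j = t j * r n` for `j < n`, as a Lagrange
multiplier computation suggests. With `P n = ∏ (1 - d k / A k)`, the two marginal conditions reduce
to the invariant `P n * ∑_{j<n} t j = A n` and to the telescoping identity `d n * r n = P n - P
(n+1)` with `P n → 0` (`factorTable_mem_tablesWith`). Its logarithm splits into a function of the
digit and a function of the base, so `h = -(∑ α j log t j + ∑ d i log r i)`
(`hasSum_entropy_factorTable`).

The same splitting gives the upper bound without optimizing over tables. Charge a digit the cost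
`-log (t j) - log (r k)`. Since `exp (-cost)` sums to at most one over the digits of a base, at most
`exp (n c)` words of length `n` cost at most `n c` (`dimH_le_of_cost`). The mean cost along a
sequence of the level set needs only the separate frequencies of digits and bases, and tends to `h`.
The actual cost is truncated at a level `N`, because frequencies control only finitely many symbols,
and zero weights receive a large finite cost (`eventually_sum_digitCost_le`, `tendsto_costBound`).
-/

noncomputable section

namespace CantorSeries

/-! ### Mixed radix words and cylinder intervals -/

/-- The integer whose mixed radix digits with respect to `b` are `ε 0, …, ε (n - 1)`. -/
def radixValue (b ε : ℕ → ℕ) : ℕ → ℕ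
  | 0 => 0
  | n + 1 => b n * radixValue b ε n + ε n

/-- The product `b_1 ⋯ b_n` as a real number. -/
def baseProd (b : ℕ → ℕ) (n : ℕ) : ℝ := ∏ k ∈ Finset.range n, (b k : ℝ)

lemma baseProd_succ (b : ℕ → ℕ) (n : ℕ) : baseProd b (n + 1) = baseProd b n * b n :=
  Finset.prod_range_succ _ _

lemma baseProd_pos {b : ℕ → ℕ} (hb : ∀ i, 2 ≤ b i) (n : ℕ) : 0 < baseProd b n :=
  Finset.prod_pos fun i _ => by have := hb i; positivity

lemma two_pow_le_baseProd {b : ℕ → ℕ} (hb : ∀ i, 2 ≤ b i) (n : ℕ) : 2 ^ n ≤ baseProd b n := by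
  induction n with
  | zero => simp [baseProd]
  | succ n ih =>
    rw [baseProd_succ, pow_succ]
    have : (2 : ℝ) ≤ b n := by exact_mod_cast hb n
    exact mul_le_mul ih this (by norm_num) (baseProd_pos hb n).le

lemma monotone_baseProd {b : ℕ → ℕ} (hb : ∀ i, 2 ≤ b i) : Monotone (baseProd b) := by
  refine monotone_nat_of_le_succ fun n => ?_
  rw [baseProd_succ]
  have : (1 : ℝ) ≤ b n := by exact_mod_cast one_le_two.trans (hb n)
  exact le_mul_of_one_le_right (baseProd_pos hb n).le this

lemma log_baseProd {b : ℕ → ℕ} (hb : ∀ i, 2 ≤ b i) (n : ℕ) :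
    Real.log (baseProd b n) = ∑ i ∈ Finset.range n, Real.log (b i) :=
  Real.log_prod fun i _ => by have := hb i; positivity

/-- Reduction modulo `b n` recovers the last digit; what remains is divisible by `b n`, and the
induction continues with the quotient. -/
lemma radixValue_injective {b ε ε' : ℕ → ℕ} (h : ∀ i, ε i < b i) (h' : ∀ i, ε' i < b i) (n : ℕ)
    (heq : radixValue b ε n = radixValue b ε' n) : ∀ i < n, ε i = ε' i := by
  induction n with
  | zero => simp
  | succ n ih =>
    simp only [radixValue] at heq
    have hpos : 0 < b n := (Nat.zero_le _).trans_lt (h n)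
    have h1 : ε n = ε' n := by
      have := congrArg (· % b n) heq
      simpa [Nat.mul_add_mod, Nat.mod_eq_of_lt (h n), Nat.mod_eq_of_lt (h' n)] using this
    have h2 : radixValue b ε n = radixValue b ε' n := by
      rw [h1] at heq
      exact Nat.eq_of_mul_eq_mul_left hpos (by omega)
    intro i hi
    rcases Nat.lt_succ_iff_lt_or_eq.1 hi with hi | rfl
    · exact ih h2 i hi
    · exact h1

lemma sum_range_eq_radixValue_div {b : ℕ → ℕ} (hb : ∀ i, 2 ≤ b i) (ε : ℕ → ℕ) (n : ℕ) :
    ∑ i ∈ Finset.range n, (ε i : ℝ) / ∏ k ∈ Finset.range (i + 1), (b k : ℝ) =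
      radixValue b ε n / baseProd b n := by
  induction n with
  | zero => simp [radixValue]
  | succ n ih =>
    have h0 := (baseProd_pos hb n).ne'
    have h1 : (b n : ℝ) ≠ 0 := by have := hb n; positivity
    rw [Finset.sum_range_succ, ih]
    change _ + _ / baseProd b (n + 1) = _
    rw [baseProd_succ, radixValue]
    push_cast
    field_simp

/-- These are the right endpoints of the cylinder intervals, which are nested because `ε n + 1 ≤ b
n`. This bounds all partial sums at once, with no estimate of the tail of the series. -/
lemma antitone_radixValue_add_one_div {b ε : ℕ → ℕ} (hb : ∀ i, 2 ≤ b i) (h : ∀ i, ε i < b i) :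
    Antitone fun n => ((radixValue b ε n : ℝ) + 1) / baseProd b n := by
  refine antitone_nat_of_succ_le fun n => ?_
  have h0 := baseProd_pos hb n
  have h1 : (0 : ℝ) < b n := by have := hb n; positivity
  have h2 : (ε n : ℝ) + 1 ≤ b n := by exact_mod_cast h n
  rw [baseProd_succ, radixValue, div_le_div_iff₀ (by positivity) h0]
  push_cast
  nlinarith [mul_le_mul_of_nonneg_left h2 h0.le]

lemma sum_range_le {b ε : ℕ → ℕ} (hb : ∀ i, 2 ≤ b i) (h : ∀ i, ε i < b i) {m n : ℕ} (hmn : n ≤ m) :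
    ∑ i ∈ Finset.range m, (ε i : ℝ) / ∏ k ∈ Finset.range (i + 1), (b k : ℝ) ≤
      ((radixValue b ε n : ℝ) + 1) / baseProd b n := by
  rw [sum_range_eq_radixValue_div hb]
  refine le_trans ?_ (antitone_radixValue_add_one_div hb h hmn)
  have := baseProd_pos hb m
  exact div_le_div_of_nonneg_right (by linarith) this.le

lemma summable_expansion {b ε : ℕ → ℕ} (hb : ∀ i, 2 ≤ b i) (h : ∀ i, ε i < b i) :
    Summable fun i => (ε i : ℝ) / ∏ k ∈ Finset.range (i + 1), (b k : ℝ) :=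
  summable_of_sum_range_le (fun i => by positivity) fun m => sum_range_le hb h (Nat.zero_le m)

lemma IsExpansion.radixValue_le {b ε : ℕ → ℕ} {x : ℝ} (hb : ∀ i, 2 ≤ b i)
    (hx : IsExpansion b ε x) (n : ℕ) : (radixValue b ε n : ℝ) ≤ baseProd b n * x := by
  have h : (radixValue b ε n : ℝ) / baseProd b n ≤ x := by
    rw [← sum_range_eq_radixValue_div hb]
    exact sum_le_hasSum _ (fun i _ => by positivity) hx.2
  rwa [div_le_iff₀' (baseProd_pos hb n)] at h

lemma IsExpansion.le_radixValue_add_one {b ε : ℕ → ℕ} {x : ℝ} (hb : ∀ i, 2 ≤ b i)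
    (hx : IsExpansion b ε x) (n : ℕ) : baseProd b n * x ≤ radixValue b ε n + 1 := by
  have h : x ≤ ((radixValue b ε n : ℝ) + 1) / baseProd b n :=
    le_of_tendsto hx.2.tendsto_sum_nat
      (eventually_atTop.2 ⟨n, fun m hm => sum_range_le hb hx.1 hm⟩)
  rwa [le_div_iff₀' (baseProd_pos hb n)] at h

lemma IsExpansion.mem_Icc {b ε : ℕ → ℕ} {x : ℝ} (hb : ∀ i, 2 ≤ b i)
    (hx : IsExpansion b ε x) : x ∈ Set.Icc (0 : ℝ) 1 := by
  have h1 := hx.radixValue_le hb 0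
  have h2 := hx.le_radixValue_add_one hb 0
  simp only [radixValue, baseProd, Finset.range_zero, Finset.prod_empty] at h1 h2
  constructor <;> push_cast at * <;> linarith

/-! ### Frequencies and averages -/

/-- Averages of a function supported on finitely many symbols converge when the symbols have
frequencies. -/
lemma tendsto_average_of_frequency {ι : Type*} [DecidableEq ι] {u : ℕ → ι} {f : ι → ℝ}
    (h : ∀ k, Tendsto (fun n : ℕ => (((Finset.range n).filter (fun i => u i = k)).card : ℝ) / n)
      atTop (𝓝 (f k))) (K : Finset ι) (g : ι → ℝ) :
    Tendsto (fun n : ℕ => (∑ i ∈ Finset.range n, if u i ∈ K then g (u i) else 0) / n) atTop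
      (𝓝 (∑ k ∈ K, f k * g k)) := by
  have := tendsto_finsetSum K fun k _ => (h k).mul_const (g k)
  refine this.congr fun n => ?_
  have h1 : ∀ i, (if u i ∈ K then g (u i) else 0) = ∑ k ∈ K, if u i = k then g k else 0 := by
    intro i
    rw [Finset.sum_ite_eq]
  simp_rw [h1]
  rw [Finset.sum_comm, Finset.sum_div]
  refine Finset.sum_congr rfl fun k _ => ?_
  rw [← Finset.sum_filter, Finset.sum_const, nsmul_eq_mul]
  ring

/-- Frequencies summing to one control the frequency of large symbols. -/
lemma tendsto_tail_frequency {u : ℕ → ℕ} {f : ℕ → ℝ}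
    (h : ∀ k, Tendsto (fun n : ℕ => (((Finset.range n).filter (fun i => u i = k)).card : ℝ) / n)
      atTop (𝓝 (f k))) (N : ℕ) :
    Tendsto (fun n : ℕ => (((Finset.range n).filter (fun i => N ≤ u i)).card : ℝ) / n) atTop
      (𝓝 (1 - ∑ k ∈ Finset.range N, f k)) := by
  have h1 := tendsto_average_of_frequency h (Finset.range N) (fun _ => 1)
  simp only [mul_one, Finset.mem_range] at h1
  refine (tendsto_const_nhds.sub h1).congr' ?_
  filter_upwards [eventually_gt_atTop 0] with n hn
  have hn' : (n : ℝ) ≠ 0 := by positivity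
  have h2 := Finset.card_filter_add_card_filter_not (s := Finset.range n) (fun i => N ≤ u i)
  rw [Finset.card_range] at h2
  have h3 : (n : ℝ) = ((Finset.range n).filter (fun i => N ≤ u i)).card +
      ((Finset.range n).filter (fun i => ¬ N ≤ u i)).card := by exact_mod_cast h2.symm
  have h4 : (∑ i ∈ Finset.range n, if u i < N then (1 : ℝ) else 0) =
      ((Finset.range n).filter (fun i => ¬ N ≤ u i)).card := by
    rw [← Finset.sum_filter]; simp [not_le]
  rw [h4, eq_div_iff hn', sub_mul, div_mul_cancel₀ _ hn']
  linarith

/-- A limit interchange: `x` is approximated by `y N` up to an error that is eventually small. -/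
lemma tendsto_of_approx {x : ℕ → ℝ} {y w : ℕ → ℕ → ℝ} {Y W : ℕ → ℝ} {l : ℝ}
    (hxy : ∀ N n, |x n - y N n| ≤ w N n) (hy : ∀ N, Tendsto (y N) atTop (𝓝 (Y N)))
    (hw : ∀ N, Tendsto (w N) atTop (𝓝 (W N))) (hY : Tendsto Y atTop (𝓝 l))
    (hW : Tendsto W atTop (𝓝 0)) : Tendsto x atTop (𝓝 l) := by
  rw [Metric.tendsto_atTop']
  intro e he
  obtain ⟨N, hN1, hN2⟩ := ((Metric.tendsto_nhds.1 hY (e / 4) (by positivity)).and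
    (hW.eventually_lt_const (show (0 : ℝ) < e / 4 by positivity))).exists
  have := (Metric.tendsto_nhds.1 (hy N) (e / 4) (by positivity)).and
    ((hw N).eventually_lt_const hN2)
  obtain ⟨n₀, hn₀⟩ := eventually_atTop.1 this
  refine ⟨n₀, fun n hn => ?_⟩
  obtain ⟨h1, h2⟩ := hn₀ n hn.le
  have h3 := hxy N n
  rw [Real.dist_eq] at *
  rw [abs_lt] at *
  rw [abs_le] at h3
  constructor <;> linarith [h1.1, h1.2, hN1.1, hN1.2, h3.1, h3.2]

/-! ### Upper bound by counting cheap words -/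

open MeasureTheory in
/-- Upper bound for the Hausdorff dimension by counting digit words of small cost. -/
theorem dimH_le_of_cost {b : ℕ → ℕ} (hb : ∀ i, 2 ≤ b i) {L : ℝ} (hL0 : 0 < L)
    (hL : Tendsto (fun n : ℕ => (∑ i ∈ Finset.range n, Real.log (b i)) / n) atTop (𝓝 L))
    {Ψ : ℕ → ℕ → ℝ} {c η : ℝ} (hΨ : ∀ i, ∑ j ∈ Finset.range (b i), Real.exp (-Ψ i j) ≤ Real.exp η)
    {E : Set (ℕ → ℕ)}
    (hE : ∀ ε ∈ E, ∀ᶠ n : ℕ in atTop, ∑ i ∈ Finset.range n, Ψ i (ε i) ≤ n * c) :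
    dimH {x : ℝ | ∃ ε ∈ E, IsExpansion b ε x} ≤ ENNReal.ofReal ((c + η) / L) := by
  classical
  -- The threshold `m` is made uniform so that a single length `n ≥ m` covers the whole piece;
  -- countable stability of the dimension reassembles the pieces.
  set S : ℕ → Set ℝ := fun m => {x : ℝ | ∃ ε : ℕ → ℕ,
    (∀ n ≥ m, ∑ i ∈ Finset.range n, Ψ i (ε i) ≤ n * c) ∧ IsExpansion b ε x} with hS
  have hsub : {x : ℝ | ∃ ε ∈ E, IsExpansion b ε x} ⊆ ⋃ m, S m := by
    rintro x ⟨ε, hε, hx⟩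
    obtain ⟨m, hm⟩ := eventually_atTop.1 (hE ε hε)
    exact Set.mem_iUnion.2 ⟨m, ε, hm, hx⟩
  refine (dimH_mono hsub).trans ?_
  rw [dimH_iUnion]
  refine iSup_le fun m => le_of_forall_gt fun a ha => ?_
  obtain ⟨s, hs1, hs2⟩ := ENNReal.lt_iff_exists_nnreal_btwn.1 ha
  refine lt_of_le_of_lt ?_ hs2
  have hs0 : (0 : ℝ) < s := by
    have : (0 : ENNReal) < s := (zero_le).trans_lt hs1
    exact_mod_cast this
  have hs3 : c + η < s * L := by
    rw [← ENNReal.ofReal_coe_nnreal, ENNReal.ofReal_lt_ofReal_iff hs0, div_lt_iff₀ hL0] at hs1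
    exact hs1
  refine dimH_le_of_hausdorffMeasure_ne_top ?_
  -- the words of length `n` of small cost
  let W : ∀ n : ℕ, Finset (Fin n → ℕ) := fun n =>
    (Fintype.piFinset fun i : Fin n => Finset.range (b i)).filter
      fun w => ∑ i : Fin n, Ψ i (w i) ≤ n * c
  have hW : ∀ n, ((W n).card : ℝ) ≤ Real.exp (n * (c + η)) := by
    intro n
    -- Exponential Chebyshev bound: the product expands into a sum over all words, in which every
    -- cheap word contributes at least `exp (-(n * c))`.
    have h1 : ∏ i : Fin n, ∑ j ∈ Finset.range (b i), Real.exp (-Ψ i j) ≤ Real.exp η ^ n := by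
      calc _ ≤ ∏ _i : Fin n, Real.exp η :=
            Finset.prod_le_prod (fun i _ => Finset.sum_nonneg fun j _ => (Real.exp_pos _).le)
              fun i _ => hΨ i
        _ = _ := by simp
    rw [Finset.prod_univ_sum] at h1
    have h2 : ∑ w ∈ W n, Real.exp (-(n * c)) ≤ ∑ w ∈ Fintype.piFinset
        (fun i : Fin n => Finset.range (b i)), ∏ i : Fin n, Real.exp (-Ψ i (w i)) := by
      refine (Finset.sum_le_sum fun w hw => ?_).trans (Finset.sum_le_sum_of_subset_of_nonneg
        (Finset.filter_subset _ _) fun w _ _ => Finset.prod_nonneg fun i _ => (Real.exp_pos _).le)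
      rw [← Real.exp_sum, Finset.sum_neg_distrib]
      exact Real.exp_le_exp.2 (neg_le_neg (Finset.mem_filter.1 hw).2)
    have h3 := h2.trans h1
    rw [Finset.sum_const, nsmul_eq_mul, ← Real.exp_nat_mul, Real.exp_neg, ← div_eq_mul_inv,
      div_le_iff₀ (Real.exp_pos _), ← Real.exp_add] at h3
    rwa [mul_add, add_comm]
  let val : ∀ n : ℕ, (Fin n → ℕ) → ℕ := fun n w =>
    radixValue b (fun i => if h : i < n then w ⟨i, h⟩ else 0) n
  let t : ∀ n : ℕ, W n → Set ℝ := fun n w =>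
    Set.Icc ((val n w : ℝ) / baseProd b n) (((val n w : ℝ) + 1) / baseProd b n)
  have hdiam : ∀ n w, Metric.ediam (t n w) = ENNReal.ofReal (1 / baseProd b n) := by
    intro n w
    simp only [t, Real.ediam_Icc]
    congr 1
    ring
  have hrad : ∀ (ε : ℕ → ℕ) (n m : ℕ), m ≤ n →
      radixValue b (fun i => if i < n then ε i else 0) m = radixValue b ε m := by
    intro ε n m
    induction m with
    | zero => intro _; rfl
    | succ m ih =>
      intro hm
      simp only [radixValue, ih (by omega), if_pos (show m < n by omega)]
  have hcov : ∀ᶠ n in atTop, S m ⊆ ⋃ i, t n i := by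
    filter_upwards [eventually_ge_atTop m] with n hn
    rintro x ⟨ε, hε, hx⟩
    have hw : (fun i : Fin n => ε i) ∈ W n := by
      refine Finset.mem_filter.2 ⟨Fintype.mem_piFinset.2 fun i => Finset.mem_range.2 (hx.1 i), ?_⟩
      rw [Fin.sum_univ_eq_sum_range (fun i => Ψ i (ε i))]
      exact hε n hn
    refine Set.mem_iUnion.2 ⟨⟨_, hw⟩, ?_⟩
    have hv : val n (fun i : Fin n => ε i) = radixValue b ε n := by
      simp only [val, dite_eq_ite]
      exact hrad ε n n le_rfl
    simp only [t, hv]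
    rw [Set.mem_Icc, div_le_iff₀' (baseProd_pos hb n), le_div_iff₀' (baseProd_pos hb n)]
    exact ⟨hx.radixValue_le hb n, hx.le_radixValue_add_one hb n⟩
  have hto : Tendsto (fun n : ℕ => ENNReal.ofReal (1 / baseProd b n)) atTop (𝓝 0) := by
    rw [← ENNReal.ofReal_zero]
    refine ENNReal.tendsto_ofReal ?_
    have h2 : Tendsto (fun n : ℕ => ((1 : ℝ) / 2) ^ n) atTop (𝓝 0) :=
      tendsto_pow_atTop_nhds_zero_of_lt_one (by norm_num) (by norm_num)
    refine squeeze_zero (fun n => (one_div_pos.2 (baseProd_pos hb n)).le) (fun n => ?_) h2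
    rw [one_div_pow]
    exact one_div_le_one_div_of_le (by positivity) (two_pow_le_baseProd hb n)
  have hmain := Measure.hausdorffMeasure_le_liminf_sum (s : ℝ) (S m) _ hto t
    (Eventually.of_forall fun n w => (hdiam n w).le) hcov
  -- At most `exp (n (c + η))` intervals of length `1 / baseProd b n` are used, and `s * log
  -- (baseProd b n)` eventually exceeds `n (c + η)` because `c + η < s * L`.
  have hbound : ∀ᶠ n : ℕ in atTop, ∑ w, Metric.ediam (t n w) ^ (s : ℝ) ≤ 1 := by
    have hlim : ∀ᶠ n : ℕ in atTop,
        c + η < s * ((∑ i ∈ Finset.range n, Real.log (b i)) / n) :=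
      (hL.const_mul (s : ℝ)).eventually_const_lt hs3
    filter_upwards [hlim, eventually_gt_atTop 0] with n hn hn0
    have hn' : (0 : ℝ) < n := by exact_mod_cast hn0
    simp only [hdiam, Finset.sum_const, nsmul_eq_mul, Finset.card_univ, Fintype.card_coe]
    rw [ENNReal.ofReal_rpow_of_pos (one_div_pos.2 (baseProd_pos hb n)), ← ENNReal.ofReal_natCast,
      ← ENNReal.ofReal_mul (by positivity), ENNReal.ofReal_le_one]
    rw [← log_baseProd hb, ← mul_div_assoc, lt_div_iff₀ hn'] at hn
    rw [Real.rpow_def_of_pos (one_div_pos.2 (baseProd_pos hb n)), one_div, Real.log_inv]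
    calc ((W n).card : ℝ) * Real.exp (-Real.log (baseProd b n) * s)
        ≤ Real.exp (n * (c + η)) * Real.exp (-Real.log (baseProd b n) * s) := by
          gcongr
          exact hW n
      _ ≤ 1 := by
          rw [← Real.exp_add, Real.exp_le_one_iff]
          nlinarith
  refine ne_top_of_le_ne_top ENNReal.one_ne_top (hmain.trans ?_)
  exact (liminf_le_of_frequently_le' hbound.frequently)

/-! ### Mass distribution principle -/

section

open MeasureTheory

/-- The sum of the Cantor series, as a function that is visibly measurable in the digits. -/
def expansionValue (b ε : ℕ → ℕ) : ℝ :=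
  (∑' i, ENNReal.ofReal ((ε i : ℝ) / ∏ k ∈ Finset.range (i + 1), (b k : ℝ))).toReal

lemma measurable_expansionValue (b : ℕ → ℕ) : Measurable (expansionValue b) := by
  refine (Measurable.tsum fun i => ?_).ennreal_toReal
  have : Measurable fun m : ℕ => ENNReal.ofReal ((m : ℝ) / ∏ k ∈ Finset.range (i + 1), (b k : ℝ)) :=
    measurable_of_countable _
  exact this.comp (measurable_pi_apply i)

lemma isExpansion_expansionValue {b ε : ℕ → ℕ} (hb : ∀ i, 2 ≤ b i) (h : ∀ i, ε i < b i) :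
    IsExpansion b ε (expansionValue b ε) := by
  refine ⟨h, ?_⟩
  have hs := summable_expansion hb h
  have h0 : ∀ i, 0 ≤ (ε i : ℝ) / ∏ k ∈ Finset.range (i + 1), (b k : ℝ) := fun i => by positivity
  rw [expansionValue, ← ENNReal.ofReal_tsum_of_nonneg h0 hs, ENNReal.toReal_ofReal (tsum_nonneg h0)]
  exact hs.hasSum

/-- The set of digit sequences that agree with `ε` in the first `n` places. -/
def cylinderSet (ε : ℕ → ℕ) (n : ℕ) : Set (ℕ → ℕ) := {ε' | ∀ i < n, ε' i = ε i}

/-- The digit sequences whose cylinders of length at least `m` have measure at most `exp (-n c)`. -/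
def goodSet (b : ℕ → ℕ) (E : Set (ℕ → ℕ)) (P : Measure (ℕ → ℕ)) (c : ℝ) (m : ℕ) : Set (ℕ → ℕ) :=
  {ε | ε ∈ E ∧ (∀ i, ε i < b i) ∧
    ∀ n ≥ m, P (cylinderSet ε n) ≤ ENNReal.ofReal (Real.exp (-(n * c)))}

/-- Two points at distance less than `1 / baseProd b n` have radix values differing by at most one,
so `U` meets at most three cylinders of length `n`, each of small mass inside the good set. -/
lemma measure_preimage_inter_goodSet_le {b : ℕ → ℕ} (hb : ∀ i, 2 ≤ b i) (E : Set (ℕ → ℕ))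
    (P : Measure (ℕ → ℕ)) (c : ℝ) {m n : ℕ} (hmn : m ≤ n) {U : Set ℝ}
    (hU : Metric.ediam U < ENNReal.ofReal (1 / baseProd b n)) :
    P (expansionValue b ⁻¹' U ∩ goodSet b E P c m) ≤
      3 * ENNReal.ofReal (Real.exp (-(n * c))) := by
  rcases Set.eq_empty_or_nonempty (expansionValue b ⁻¹' U ∩ goodSet b E P c m) with h | ⟨ε₀, h₀⟩
  · simp [h]
  have hB := baseProd_pos hb n
  have hex : ∀ ε ∈ goodSet b E P c m, IsExpansion b ε (expansionValue b ε) :=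
    fun ε hε => isExpansion_expansionValue hb hε.2.1
  set M₀ := radixValue b ε₀ n with hM₀
  have hcov : expansionValue b ⁻¹' U ∩ goodSet b E P c m ⊆
      ⋃ M ∈ Finset.Icc (M₀ - 1) (M₀ + 1), {ε ∈ goodSet b E P c m | radixValue b ε n = M} := by
    rintro ε ⟨hε, hg⟩
    have hdist : |expansionValue b ε - expansionValue b ε₀| < 1 / baseProd b n := by
      have h1 : edist (expansionValue b ε) (expansionValue b ε₀) ≤ Metric.ediam U :=
        Metric.edist_le_ediam_of_mem hε h₀.1
      have h2 := h1.trans_lt hU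
      rwa [edist_dist, ENNReal.ofReal_lt_ofReal_iff (by positivity), Real.dist_eq] at h2
    have hd : |baseProd b n * expansionValue b ε - baseProd b n * expansionValue b ε₀| < 1 := by
      rw [← mul_sub, abs_mul, abs_of_pos hB]
      rwa [lt_div_iff₀' hB] at hdist
    rw [abs_lt] at hd
    have a1 := (hex ε hg).radixValue_le hb n
    have a2 := (hex ε hg).le_radixValue_add_one hb n
    have a3 := (hex ε₀ h₀.2).radixValue_le hb n
    have a4 := (hex ε₀ h₀.2).le_radixValue_add_one hb n
    have b1 : (radixValue b ε n : ℝ) < radixValue b ε₀ n + 2 := by linarith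
    have b2 : (radixValue b ε₀ n : ℝ) < radixValue b ε n + 2 := by linarith
    have c1 : radixValue b ε n < radixValue b ε₀ n + 2 := by exact_mod_cast b1
    have c2 : radixValue b ε₀ n < radixValue b ε n + 2 := by exact_mod_cast b2
    simp only [Set.mem_iUnion, Finset.mem_Icc]
    exact ⟨radixValue b ε n, by omega, hg, rfl⟩
  have hone : ∀ M, P {ε ∈ goodSet b E P c m | radixValue b ε n = M} ≤
      ENNReal.ofReal (Real.exp (-(n * c))) := by
    intro M
    rcases Set.eq_empty_or_nonempty {ε ∈ goodSet b E P c m | radixValue b ε n = M} with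
      h | ⟨ε₁, h₁⟩
    · simp [h]
    refine (measure_mono fun ε hε => ?_).trans (h₁.1.2.2 n hmn)
    exact radixValue_injective hε.1.2.1 h₁.1.2.1 n (hε.2.trans h₁.2.symm)
  calc P (expansionValue b ⁻¹' U ∩ goodSet b E P c m)
      ≤ ∑ M ∈ Finset.Icc (M₀ - 1) (M₀ + 1), P {ε ∈ goodSet b E P c m | radixValue b ε n = M} :=
        (measure_mono hcov).trans (measure_biUnion_finset_le _ _)
    _ ≤ ∑ M ∈ Finset.Icc (M₀ - 1) (M₀ + 1), ENNReal.ofReal (Real.exp (-(n * c))) :=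
        Finset.sum_le_sum fun M _ => hone M
    _ ≤ 3 * ENNReal.ofReal (Real.exp (-(n * c))) := by
        rw [Finset.sum_const, nsmul_eq_mul, Nat.card_Icc]
        gcongr
        norm_cast
        omega

/-- The mass distribution principle for Cantor series. -/
theorem le_dimH_of_measure_cylinder {b : ℕ → ℕ} (hb : ∀ i, 2 ≤ b i) {L : ℝ}
    (hL : Tendsto (fun n : ℕ => (∑ i ∈ Finset.range n, Real.log (b i)) / n) atTop (𝓝 L))
    (hL0 : 0 < L) (P : Measure (ℕ → ℕ)) [IsProbabilityMeasure P] (E : Set (ℕ → ℕ)) {c : ℝ}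
    (hE : ∀ᵐ ε ∂P, ε ∈ E) (hv : ∀ᵐ ε ∂P, ∀ i, ε i < b i)
    (hc : ∀ᵐ ε ∂P, ∀ᶠ n : ℕ in atTop,
      P (cylinderSet ε n) ≤ ENNReal.ofReal (Real.exp (-(n * c))))
    {s : NNReal} (hs : s * L < c) :
    (s : ENNReal) ≤ dimH {x : ℝ | ∃ ε ∈ E, IsExpansion b ε x} := by
  have hc0 : 0 < c := lt_of_le_of_lt (by positivity) hs
  -- The good sets exhaust almost every sequence, so they cannot all be null.
  obtain ⟨m, hm⟩ : ∃ m, P (goodSet b E P c m) ≠ 0 := by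
    by_contra! hcon
    have h1 : ∀ᵐ ε ∂P, ∃ m, ε ∈ goodSet b E P c m := by
      filter_upwards [hE, hv, hc] with ε h1 h2 h3
      obtain ⟨m, hm⟩ := eventually_atTop.1 h3
      exact ⟨m, h1, h2, hm⟩
    have h2 : P (⋃ m, goodSet b E P c m) = 0 := measure_iUnion_null hcon
    have h3 : ∀ᵐ ε ∂P, False := by
      filter_upwards [h1, measure_eq_zero_iff_ae_notMem.1 h2] with ε h4 h5
      exact h5 (Set.mem_iUnion.2 h4)
    exact IsProbabilityMeasure.ne_zero P (by simpa using h3)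
  set ν := (P.restrict (goodSet b E P c m)).map (expansionValue b) with hν
  have hνU : ∀ n ≥ m, ∀ U : Set ℝ, Metric.ediam U < ENNReal.ofReal (1 / baseProd b n) →
      ν U ≤ 3 * ENNReal.ofReal (Real.exp (-(n * c))) := by
    intro n hn U hU
    -- `U` need not be measurable; its closure is, and has the same diameter.
    refine (measure_mono subset_closure).trans ?_
    rw [hν, Measure.map_apply (measurable_expansionValue b) measurableSet_closure,
      Measure.restrict_apply (measurable_expansionValue b measurableSet_closure)]
    exact measure_preimage_inter_goodSet_le hb E P c hn (by rwa [Metric.ediam_closure])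
  -- The factor `3` and the shift from `n` to `n + 1`, which comes from comparing with the next
  -- scale, are both negligible after division by `n`.
  have hlim : Tendsto (fun n : ℕ => s * ((∑ i ∈ Finset.range (n + 1), Real.log (b i)) / (n + 1 : ℕ))
      * ((n + 1 : ℕ) / n) + Real.log 3 / n) atTop (𝓝 (s * L * 1 + 0)) := by
    refine ((((tendsto_add_atTop_iff_nat 1).2 hL).const_mul (s : ℝ)).mul ?_).add
      (tendsto_const_div_atTop_nhds_zero_nat _)
    have : Tendsto (fun n : ℕ => 1 + 1 / (n : ℝ)) atTop (𝓝 (1 + 0)) :=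
      tendsto_const_nhds.add tendsto_one_div_atTop_nhds_zero_nat
    rw [add_zero] at this
    refine this.congr' ?_
    filter_upwards [eventually_gt_atTop 0] with n hn
    have : (n : ℝ) ≠ 0 := by positivity
    push_cast
    field_simp
  rw [mul_one, add_zero] at hlim
  have hev : ∀ᶠ n : ℕ in atTop, 3 * ENNReal.ofReal (Real.exp (-(n * c))) ≤
      ENNReal.ofReal (1 / baseProd b (n + 1)) ^ (s : ℝ) := by
    filter_upwards [hlim.eventually_lt_const hs, eventually_gt_atTop 0] with n hn hn0
    have hn' : (0 : ℝ) < n := by exact_mod_cast hn0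
    have hB := baseProd_pos hb (n + 1)
    rw [← log_baseProd hb, mul_assoc, div_mul_div_cancel₀ (by positivity), ← mul_div_assoc,
      ← add_div, div_lt_iff₀ hn'] at hn
    rw [ENNReal.ofReal_rpow_of_pos (one_div_pos.2 hB),
      show (3 : ENNReal) = ENNReal.ofReal 3 by simp, ← ENNReal.ofReal_mul (by norm_num)]
    refine ENNReal.ofReal_le_ofReal ?_
    rw [Real.rpow_def_of_pos (one_div_pos.2 hB), one_div, Real.log_inv,
      show (3 : ℝ) = Real.exp (Real.log 3) from (Real.exp_log (by norm_num)).symm, ← Real.exp_add]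
    exact Real.exp_le_exp.2 (by linarith)
  obtain ⟨n₁, hn₁⟩ := eventually_atTop.1 hev
  set n₀ := max n₁ m with hn₀
  have hle : ν ≤ Measure.hausdorffMeasure (s : ℝ) := by
    refine Measure.le_hausdorffMeasure (s : ℝ) ν (ENNReal.ofReal (1 / baseProd b n₀) / 2)
      (ENNReal.half_pos (by simpa using baseProd_pos hb n₀)) fun U hU => ?_
    have hU' : Metric.ediam U < ENNReal.ofReal (1 / baseProd b n₀) :=
      hU.trans_lt (ENNReal.half_lt_self (by simpa using baseProd_pos hb n₀) ENNReal.ofReal_ne_top)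
    -- If `U` is smaller than every scale, its mass is zero. Otherwise `n₀ + k` is the last scale
    -- before the first one with `1 / baseProd ≤ diam U`.
    by_cases hz : ∀ n, Metric.ediam U < ENNReal.ofReal (1 / baseProd b n)
    · have hnull : ν U = 0 := by
        have ht : Tendsto (fun n : ℕ => 3 * ENNReal.ofReal (Real.exp (-(n * c)))) atTop (𝓝 0) := by
          rw [← mul_zero (3 : ENNReal), ← ENNReal.ofReal_zero]
          refine ENNReal.Tendsto.const_mul (ENNReal.tendsto_ofReal ?_) (Or.inr (by simp))
          exact Real.tendsto_exp_neg_atTop_nhds_zero.comp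
            (tendsto_natCast_atTop_atTop.atTop_mul_const hc0)
        refine le_antisymm (ge_of_tendsto ht ?_) (zero_le)
        filter_upwards [eventually_ge_atTop m] with n hn
        exact hνU n hn U (hz n)
      simp [hnull]
    · push Not at hz
      classical
      obtain ⟨k, hk⟩ : ∃ k, Nat.find hz = n₀ + k + 1 := by
        have : n₀ < Nat.find hz := by
          rw [Nat.lt_find_iff]
          intro j hj
          rw [not_le]
          refine hU'.trans_le (ENNReal.ofReal_le_ofReal ?_)
          exact one_div_le_one_div_of_le (baseProd_pos hb j) (monotone_baseProd hb hj)
        exact ⟨Nat.find hz - n₀ - 1, by omega⟩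
      have h1 := Nat.find_spec hz
      have h2 := Nat.find_min hz (m := n₀ + k) (by omega)
      rw [not_le] at h2
      rw [hk] at h1
      calc ν U ≤ 3 * ENNReal.ofReal (Real.exp (-((n₀ + k : ℕ) * c))) :=
            hνU (n₀ + k) (by omega) U h2
        _ ≤ ENNReal.ofReal (1 / baseProd b (n₀ + k + 1)) ^ (s : ℝ) := hn₁ _ (by omega)
        _ ≤ Metric.ediam U ^ (s : ℝ) := ENNReal.rpow_le_rpow h1 s.2
  refine le_dimH_of_hausdorffMeasure_ne_zero ?_
  have h1 : P (goodSet b E P c m) ≤ ν {x : ℝ | ∃ ε ∈ E, IsExpansion b ε x} := by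
    refine le_trans ?_ (Measure.le_map_apply (measurable_expansionValue b).aemeasurable _)
    rw [← Measure.restrict_apply_self P (goodSet b E P c m)]
    exact measure_mono fun ε hε => ⟨ε, hε.1, isExpansion_expansionValue hb hε.2.1⟩
  intro h0
  exact hm (le_antisymm (h1.trans ((hle _).trans h0.le)) (zero_le))

end

/-! ### Random digits and the entropy lower bound -/

section

open MeasureTheory ProbabilityTheory

/-- Hoeffding's inequality bounds the probability of a sum of at least `n * e` by `exp (-(e ^ 2 /
2)) ^ n`, which is summable, and Borel–Cantelli applies. -/
lemma ae_eventually_sum_lt {Ω : Type*} [MeasurableSpace Ω] {P : Measure Ω}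
    [IsProbabilityMeasure P] {X : ℕ → Ω → ℝ} (hind : iIndepFun X P) (hm : ∀ i, Measurable (X i))
    (hX : ∀ i ω, X i ω ∈ Set.Icc (-1 : ℝ) 1) (h0 : ∀ i, ∫ ω, X i ω ∂P = 0) {e : ℝ} (he : 0 < e) :
    ∀ᵐ ω ∂P, ∀ᶠ n : ℕ in atTop, ∑ i ∈ Finset.range n, X i ω < n * e := by
  have hsub : ∀ i, HasSubgaussianMGF (X i) 1 P := by
    intro i
    have := hasSubgaussianMGF_of_mem_Icc_of_integral_eq_zero (hm i).aemeasurable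
      (ae_of_all P (hX i)) (h0 i)
    convert this
    norm_num
  have hprob : ∀ n : ℕ, P {ω | n * e ≤ ∑ i ∈ Finset.range n, X i ω} ≤
      ENNReal.ofReal (Real.exp (-(e ^ 2 / 2)) ^ n) := by
    intro n
    have := HasSubgaussianMGF.measure_sum_range_ge_le_of_iIndepFun hind (c := 1) (n := n)
      (fun i _ => hsub i) (ε := n * e) (by positivity)
    rw [← ofReal_measureReal]
    refine ENNReal.ofReal_le_ofReal (this.trans ?_)
    rw [← Real.exp_nat_mul]
    refine Real.exp_le_exp.2 (le_of_eq ?_)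
    rcases eq_or_ne n 0 with rfl | hn
    · simp
    · have : (n : ℝ) ≠ 0 := by exact_mod_cast hn
      push_cast
      field_simp
  have hsum : ∑' n : ℕ, P {ω | n * e ≤ ∑ i ∈ Finset.range n, X i ω} ≠ ⊤ := by
    refine ne_top_of_le_ne_top ?_ (ENNReal.tsum_le_tsum hprob)
    refine (summable_geometric_of_lt_one (Real.exp_pos _).le ?_).tsum_ofReal_ne_top
    rw [Real.exp_lt_one_iff]
    have : 0 < e ^ 2 / 2 := by positivity
    linarith
  filter_upwards [ae_eventually_notMem hsum] with ω hω
  filter_upwards [hω] with n hn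
  simpa using hn

/-- The strong law of large numbers for centered independent variables with values in
`[-1, 1]`, not necessarily identically distributed. -/
lemma ae_tendsto_average_zero {Ω : Type*} [MeasurableSpace Ω] {P : Measure Ω}
    [IsProbabilityMeasure P] {X : ℕ → Ω → ℝ} (hind : iIndepFun X P) (hm : ∀ i, Measurable (X i))
    (hX : ∀ i ω, X i ω ∈ Set.Icc (-1 : ℝ) 1) (h0 : ∀ i, ∫ ω, X i ω ∂P = 0) :
    ∀ᵐ ω ∂P, Tendsto (fun n : ℕ => (∑ i ∈ Finset.range n, X i ω) / n) atTop (𝓝 0) := by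
  have h1 : ∀ᵐ ω ∂P, ∀ m : ℕ, ∀ᶠ n : ℕ in atTop,
      ∑ i ∈ Finset.range n, X i ω < n * (1 / ((m : ℝ) + 1)) :=
    ae_all_iff.2 fun m => ae_eventually_sum_lt hind hm hX h0 (by positivity)
  have h2 : ∀ᵐ ω ∂P, ∀ m : ℕ, ∀ᶠ n : ℕ in atTop,
      ∑ i ∈ Finset.range n, -X i ω < n * (1 / ((m : ℝ) + 1)) :=
    ae_all_iff.2 fun m => ae_eventually_sum_lt (X := fun i ω => -X i ω)
      (hind.comp (fun _ x => -x) fun _ => measurable_neg)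
      (fun i => (hm i).neg) (fun i ω => ⟨neg_le_neg (hX i ω).2, neg_le.1 (hX i ω).1⟩)
      (fun i => by rw [integral_neg, h0, neg_zero]) (by positivity)
  filter_upwards [h1, h2] with ω h3 h4
  rw [Metric.tendsto_nhds]
  intro e he
  obtain ⟨m, hm⟩ := exists_nat_one_div_lt he
  filter_upwards [h3 m, h4 m, eventually_gt_atTop 0] with n h5 h6 hn
  have hn' : (0 : ℝ) < n := by exact_mod_cast hn
  rw [Real.dist_eq, sub_zero, abs_div, abs_of_pos hn', div_lt_iff₀ hn', abs_lt]
  rw [Finset.sum_neg_distrib] at h6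
  constructor <;> nlinarith

/-- The law on digits given by the `n`-th row of a table. -/
def digitMeasure (p : ℕ → ℕ → ℝ) (n : ℕ) : Measure ℕ :=
  ∑ j ∈ Finset.range n, ENNReal.ofReal (p n j) • Measure.dirac j

lemma isProbabilityMeasure_digitMeasure {p : ℕ → ℕ → ℝ} (hp : p ∈ tables) {n : ℕ} (hn : 2 ≤ n) :
    IsProbabilityMeasure (digitMeasure p n) := by
  obtain ⟨h1, -, h3⟩ := hp n hn
  constructor
  simp only [digitMeasure, Measure.finsetSum_apply, Measure.smul_apply, measure_univ, smul_eq_mul,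
    mul_one]
  rw [← ENNReal.ofReal_sum_of_nonneg fun j _ => h1 j, h3, ENNReal.ofReal_one]

lemma digitMeasure_singleton {p : ℕ → ℕ → ℝ} (hp : p ∈ tables) {n : ℕ} (hn : 2 ≤ n) (j : ℕ) :
    digitMeasure p n {j} = ENNReal.ofReal (p n j) := by
  obtain ⟨-, h2, -⟩ := hp n hn
  simp only [digitMeasure, Measure.finsetSum_apply, Measure.smul_apply, smul_eq_mul]
  have : ∀ i, ENNReal.ofReal (p n i) * Measure.dirac i {j} =
      if i = j then ENNReal.ofReal (p n i) else 0 := by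
    intro i
    by_cases h : i = j <;> simp [h]
  simp_rw [this]
  rw [Finset.sum_ite_eq']
  by_cases h : j < n
  · simp [h]
  · simp [h, h2 j (not_lt.1 h)]

/-- The entropy of the `n`-th row of a table. -/
def rowEntropy (p : ℕ → ℕ → ℝ) (n : ℕ) : ℝ := ∑ j ∈ Finset.range n, Real.negMulLog (p n j)

lemma IsBaseFrequency.eq_zero_of_lt_two {b : ℕ → ℕ} {d : ℕ → ℝ} (hd : IsBaseFrequency b d)
    (hb : ∀ i, 2 ≤ b i) {k : ℕ} (hk : k < 2) : d k = 0 := by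
  have hne : ∀ i, b i ≠ k := fun i h => absurd (hb i) (by omega)
  refine tendsto_nhds_unique (hd k) ?_
  simp [baseCount, hne]

/-- Under the product of the row laws, pairs of a base and a digit have the expected frequencies. -/
lemma ae_tendsto_joint_frequency {b : ℕ → ℕ} (hb : ∀ i, 2 ≤ b i) {d : ℕ → ℝ}
    (hd : IsBaseFrequency b d) {p : ℕ → ℕ → ℝ} (hp : p ∈ tables)
    [∀ i, IsProbabilityMeasure (digitMeasure p (b i))] :
    ∀ᵐ ε ∂(Measure.infinitePi fun i => digitMeasure p (b i)), ∀ v : ℕ × ℕ,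
      Tendsto (fun n : ℕ => (((Finset.range n).filter (fun i => (b i, ε i) = v)).card : ℝ) / n)
        atTop (𝓝 (d v.1 * p v.1 v.2)) := by
  rw [ae_all_iff]
  rintro ⟨k, j⟩
  by_cases hk : 2 ≤ k
  swap
  · refine ae_of_all _ fun ε => ?_
    have hne : ∀ i, b i ≠ k := fun i h => hk (h ▸ hb i)
    have h1 : d k = 0 := hd.eq_zero_of_lt_two hb (not_le.1 hk)
    simp [hne, h1]
  set P := Measure.infinitePi fun i => digitMeasure p (b i)
  -- Indicator of the digit `j`, centered, at the places with base `k` only; its average is the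
  -- joint frequency minus `p k j` times the frequency of `k`.
  let g : ℕ → ℕ → ℝ := fun i x =>
    if b i = k then (if x = j then 1 else 0) - p k j else 0
  have hg : ∀ i, Measurable (g i) := fun i => measurable_of_countable _
  have hpj0 : 0 ≤ p k j := (hp k hk).1 j
  have hpj1 : p k j ≤ 1 := by
    by_cases hj : j < k
    · rw [← (hp k hk).2.2]
      exact Finset.single_le_sum (f := p k) (fun i _ => (hp k hk).1 i) (Finset.mem_range.2 hj)
    · rw [(hp k hk).2.1 j (not_lt.1 hj)]
      exact zero_le_one
  have hlaw := ae_tendsto_average_zero (P := P) (X := fun i ε => g i (ε i))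
    (iIndepFun_infinitePi hg) (fun i => (hg i).comp (measurable_pi_apply i))
    (fun i ε => by
      simp only [g]
      split_ifs <;> constructor <;> linarith)
    (fun i => by
      have hmap : P.map (fun ε => ε i) = digitMeasure p (b i) := Measure.infinitePi_map_eval _ i
      rw [← integral_map (φ := fun ε : ℕ → ℕ => ε i) (f := g i)
        (measurable_pi_apply i).aemeasurable (hg i).aestronglyMeasurable, hmap]
      by_cases h : b i = k
      · have hgi : g i = fun x => Set.indicator {j} (fun _ => (1 : ℝ)) x - p k j := by
          funext x
          simp [g, h, Set.indicator_apply]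
        rw [hgi, integral_sub (((integrable_const (1 : ℝ)).indicator (measurableSet_singleton j)))
          (integrable_const _), integral_indicator_const _ (measurableSet_singleton j),
          integral_const, measureReal_def, digitMeasure_singleton hp (hb i), h,
          ENNReal.toReal_ofReal hpj0]
        have := isProbabilityMeasure_digitMeasure hp hk
        simp
      · simp [g, h])
  filter_upwards [hlaw] with ε hε
  have h2 := hε.add ((hd k).mul_const (p k j))
  rw [zero_add] at h2
  refine h2.congr fun n => ?_
  rw [div_mul_eq_mul_div, ← add_div]
  congr 1
  rw [baseCount, Finset.card_filter, Finset.card_filter]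
  push_cast
  rw [Finset.sum_mul, ← Finset.sum_add_distrib]
  refine Finset.sum_congr rfl fun i _ => ?_
  by_cases h : b i = k <;> simp [g, h]

/-- Joint frequencies determine the frequencies of the digits. -/
lemma tendsto_digit_frequency {b : ℕ → ℕ} {d : ℕ → ℝ}
    (hd : IsBaseFrequency b d) (hd1 : HasSum d 1) {α : ℕ → ℝ} {p : ℕ → ℕ → ℝ}
    (hp : p ∈ tablesWith d α) {ε : ℕ → ℕ}
    (hε : ∀ v : ℕ × ℕ,
      Tendsto (fun n : ℕ => (((Finset.range n).filter (fun i => (b i, ε i) = v)).card : ℝ) / n)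
        atTop (𝓝 (d v.1 * p v.1 v.2))) (j : ℕ) :
    Tendsto (fun n : ℕ => (digitCount ε j n : ℝ) / n) atTop (𝓝 (α j)) := by
  -- Infinitely many bases may feed the digit `j`; only those below `N` are kept, and the discarded
  -- places number at most those with base at least `N`.
  refine tendsto_of_approx
    (y := fun N n => (∑ i ∈ Finset.range n,
      if (b i, ε i) ∈ Finset.range N ×ˢ {j} then (1 : ℝ) else 0) / n)
    (w := fun N n => (((Finset.range n).filter (fun i => N ≤ b i)).card : ℝ) / n)
    (Y := fun N => ∑ k ∈ Finset.range N, d k * p k j)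
    (W := fun N => 1 - ∑ k ∈ Finset.range N, d k) (fun N n => ?_) (fun N => ?_)
    (fun N => tendsto_tail_frequency hd N) (hp.2 j).tendsto_sum_nat ?_
  · rw [← sub_div, abs_div, Nat.abs_cast]
    refine div_le_div_of_nonneg_right ?_ (Nat.cast_nonneg n)
    rw [digitCount, Finset.card_filter, Finset.card_filter]
    push_cast
    rw [← Finset.sum_sub_distrib]
    refine (Finset.abs_sum_le_sum_abs _ _).trans (Finset.sum_le_sum fun i _ => ?_)
    simp only [Finset.mem_product, Finset.mem_range, Finset.mem_singleton, ← not_le]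
    by_cases h1 : ε i = j <;> by_cases h2 : N ≤ b i <;> simp [h1, h2]
  · have := tendsto_average_of_frequency hε (Finset.range N ×ˢ {j}) (fun _ => 1)
    rw [Finset.sum_product] at this
    simpa using this
  · simpa using hd1.tendsto_sum_nat.const_sub 1

/-- Lower bound for the dimension of the level set by the entropy of a compatible table. -/
theorem le_dimH_levelSet_of_lt_entropy {b : ℕ → ℕ} (hb : ∀ i, 2 ≤ b i) {d : ℕ → ℝ}
    (hd : IsBaseFrequency b d) (hd1 : HasSum d 1) {L : ℝ}
    (hL : Tendsto (fun n : ℕ => (∑ i ∈ Finset.range n, Real.log (b i)) / n) atTop (𝓝 L))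
    (hL0 : 0 < L) {α : ℕ → ℝ} {p : ℕ → ℕ → ℝ} (hp : p ∈ tablesWith d α) {s : NNReal} {N : ℕ}
    (hs : s * L < ∑ k ∈ Finset.range N, d k * rowEntropy p k) :
    (s : ENNReal) ≤ dimH (levelSet b α) := by
  have : ∀ i, IsProbabilityMeasure (digitMeasure p (b i)) :=
    fun i => isProbabilityMeasure_digitMeasure hp.1 (hb i)
  set P := Measure.infinitePi fun i => digitMeasure p (b i) with hP
  obtain ⟨c, hc1, hc2⟩ := exists_between hs
  have hcyl : ∀ ε n, P (cylinderSet ε n) = ∏ i ∈ Finset.range n, ENNReal.ofReal (p (b i) (ε i)) := by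
    intro ε n
    have : cylinderSet ε n = Set.pi (Finset.range n : Finset ℕ) fun i => {ε i} := by
      ext ε'
      simp [cylinderSet, Set.mem_pi]
    rw [this, hP, Measure.infinitePi_pi _ (fun i _ => measurableSet_singleton _)]
    exact Finset.prod_congr rfl fun i _ => digitMeasure_singleton hp.1 (hb i) _
  have hpos : ∀ᵐ ε ∂P, ∀ i, p (b i) (ε i) ≠ 0 := by
    rw [ae_all_iff]
    intro i
    have hmap : P.map (fun ε => ε i) = digitMeasure p (b i) := Measure.infinitePi_map_eval _ i
    have h1 : ∀ᵐ x ∂(digitMeasure p (b i)), p (b i) x ≠ 0 := by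
      rw [ae_iff_of_countable]
      intro x hx
      rw [digitMeasure_singleton hp.1 (hb i)] at hx
      intro h
      simp [h] at hx
    rw [← hmap] at h1
    exact ae_of_ae_map (measurable_pi_apply i).aemeasurable h1
  have hv : ∀ᵐ ε ∂P, ∀ i, ε i < b i := by
    filter_upwards [hpos] with ε hε i
    by_contra h
    exact hε i ((hp.1 (b i) (hb i)).2.1 _ (not_lt.1 h))
  have hfreq := ae_tendsto_joint_frequency hb hd hp.1
  have hloc : ∀ᵐ ε ∂P, ∀ᶠ n : ℕ in atTop,
      P (cylinderSet ε n) ≤ ENNReal.ofReal (Real.exp (-(n * c))) := by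
    filter_upwards [hfreq, hpos, hv] with ε h1 h2 h3
    have hle1 : ∀ i, p (b i) (ε i) ≤ 1 := fun i => by
      rw [← (hp.1 (b i) (hb i)).2.2]
      exact Finset.single_le_sum (f := p (b i)) (fun j _ => (hp.1 (b i) (hb i)).1 j)
        (Finset.mem_range.2 (h3 i))
    have hp0 : ∀ i, 0 < p (b i) (ε i) :=
      fun i => lt_of_le_of_ne ((hp.1 (b i) (hb i)).1 _) (h2 i).symm
    have h4 := tendsto_average_of_frequency h1 (Finset.range N ×ˢ Finset.range N)
      (fun v => -Real.log (p v.1 v.2))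
    have h5 : ∑ v ∈ Finset.range N ×ˢ Finset.range N, d v.1 * p v.1 v.2 * -Real.log (p v.1 v.2) =
        ∑ k ∈ Finset.range N, d k * rowEntropy p k := by
      rw [Finset.sum_product]
      refine Finset.sum_congr rfl fun k hk => ?_
      by_cases hk2 : 2 ≤ k
      · rw [rowEntropy, Finset.mul_sum]
        have hsub : Finset.range k ⊆ Finset.range N :=
          Finset.range_subset_range.2 (Finset.mem_range.1 hk).le
        rw [← Finset.sum_subset hsub]
        · exact Finset.sum_congr rfl fun j _ => by rw [Real.negMulLog]; ring
        · intro j _ hj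
          rw [(hp.1 k hk2).2.1 j (by simpa using hj)]
          simp
      · simp [hd.eq_zero_of_lt_two hb (not_le.1 hk2)]
    rw [h5] at h4
    filter_upwards [h4.eventually_const_lt hc2, eventually_gt_atTop 0] with n hn hn0
    have hn' : (0 : ℝ) < n := by exact_mod_cast hn0
    rw [lt_div_iff₀ hn'] at hn
    rw [hcyl, ← ENNReal.ofReal_prod_of_nonneg fun i _ => (hp0 i).le]
    refine ENNReal.ofReal_le_ofReal ?_
    rw [← Real.exp_log (Finset.prod_pos fun i (_ : i ∈ Finset.range n) => hp0 i),
      Real.log_prod fun i _ => (hp0 i).ne']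
    refine Real.exp_le_exp.2 ?_
    -- Every term `-log p` is nonnegative, so restricting to a finite block of pairs only lowers the
    -- sum; only finite averages are needed.
    have h6 : (∑ i ∈ Finset.range n, if (b i, ε i) ∈ Finset.range N ×ˢ Finset.range N then
        -Real.log (p (b i) (ε i)) else 0) ≤ ∑ i ∈ Finset.range n, -Real.log (p (b i) (ε i)) := by
      refine Finset.sum_le_sum fun i _ => ?_
      have := Real.log_nonpos (hp0 i).le (hle1 i)
      split_ifs <;> linarith
    rw [Finset.sum_neg_distrib] at h6
    linarith
  have hE : ∀ᵐ ε ∂P, ε ∈ {ε : ℕ → ℕ |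
      ∀ j, Tendsto (fun n : ℕ => (digitCount ε j n : ℝ) / n) atTop (𝓝 (α j))} := by
    filter_upwards [hfreq] with ε hε j
    exact tendsto_digit_frequency hd hd1 hp hε j
  refine (le_dimH_of_measure_cylinder hb hL hL0 P _ hE hv hloc hc1).trans (dimH_mono ?_)
  rintro x ⟨ε, hε, hx⟩
  exact ⟨hx.mem_Icc hb, ε, hx, hε⟩

end

/-! ### The explicit compatible table -/

/-- The product `∏_{k=j₀+1}^{n-1} (1 - d_k / A_k)`. -/
def seqP (d α : ℕ → ℝ) (n : ℕ) : ℝ :=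
  ∏ k ∈ Finset.Ico (firstIndex α + 1) n, (1 - d k / seqA d α k)

/-- The table with rows proportional to `t`, the `n`-th row being scaled by `r n`. -/
def factorTable (d t r : ℕ → ℝ) (n j : ℕ) : ℝ :=
  if d n = 0 then (if j = 0 then 1 else 0) else if j < n then t j * r n else 0

lemma eq_zero_of_lt_firstIndex {α : ℕ → ℝ} {j : ℕ} (hj : j < firstIndex α) : α j = 0 := by
  by_contra h
  exact absurd (Nat.sInf_le (s := {j | α j ≠ 0}) h) (not_le.2 hj)

section

variable {d α : ℕ → ℝ} {p : ℕ → ℕ → ℝ}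

/-- Bases up to `n` only emit digits below `n`, so their mass must fit there. Compatibility yields
the signs of `A n` and of all factors through this inequality. -/
lemma sum_bases_le_sum_digits (hd0 : ∀ n, 0 ≤ d n) (hd2 : ∀ n < 2, d n = 0)
    (hp : p ∈ tablesWith d α) (n : ℕ) :
    ∑ k ∈ Finset.range (n + 1), d k ≤ ∑ j ∈ Finset.range n, α j := by
  have hnn : ∀ k j, 0 ≤ d k * p k j := by
    intro k j
    by_cases hk : 2 ≤ k
    · exact mul_nonneg (hd0 k) ((hp.1 k hk).1 j)
    · simp [hd2 k (not_le.1 hk)]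
  have h1 : ∀ k ∈ Finset.range (n + 1), d k = ∑ j ∈ Finset.range n, d k * p k j := by
    intro k hk
    by_cases hk2 : 2 ≤ k
    · rw [← Finset.mul_sum]
      have hsub : Finset.range k ⊆ Finset.range n :=
        Finset.range_subset_range.2 (by simpa [Nat.lt_succ_iff] using hk)
      rw [← Finset.sum_subset hsub, (hp.1 k hk2).2.2, mul_one]
      intro j _ hj
      exact (hp.1 k hk2).2.1 j (by simpa using hj)
    · simp [hd2 k (not_le.1 hk2)]
  rw [Finset.sum_congr rfl h1, Finset.sum_comm]
  exact Finset.sum_le_sum fun j _ => sum_le_hasSum _ (fun k _ => hnn k j) (hp.2 j)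

lemma base_eq_zero_of_le_firstIndex (hd0 : ∀ n, 0 ≤ d n) (hd2 : ∀ n < 2, d n = 0)
    (hp : p ∈ tablesWith d α) {k : ℕ} (hk : k ≤ firstIndex α) : d k = 0 := by
  have h1 := sum_bases_le_sum_digits hd0 hd2 hp (firstIndex α)
  rw [Finset.sum_eq_zero (s := Finset.range (firstIndex α))
    fun j hj => eq_zero_of_lt_firstIndex (Finset.mem_range.1 hj)] at h1
  have h2 := Finset.single_le_sum (f := d) (fun i _ => hd0 i)
    (Finset.mem_range.2 (Nat.lt_succ_of_le hk))
  exact le_antisymm (h2.trans h1) (hd0 k)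

lemma seqA_eq (hd0 : ∀ n, 0 ≤ d n) (hd2 : ∀ n < 2, d n = 0) (hp : p ∈ tablesWith d α) (n : ℕ) :
    seqA d α n = ∑ j ∈ Finset.range n, α j - ∑ k ∈ Finset.range n, d k := by
  rw [seqA]
  congr 1
  · refine Finset.sum_subset (fun j hj => by simp at hj ⊢; omega) fun j hj hj' => ?_
    exact eq_zero_of_lt_firstIndex (by simp at hj hj'; omega)
  · refine Finset.sum_subset (fun j hj => by simp at hj ⊢; omega) fun j hj hj' => ?_
    exact base_eq_zero_of_le_firstIndex hd0 hd2 hp (by simp at hj hj'; omega)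

lemma le_seqA (hd0 : ∀ n, 0 ≤ d n) (hd2 : ∀ n < 2, d n = 0) (hp : p ∈ tablesWith d α) (n : ℕ) :
    d n ≤ seqA d α n := by
  have := sum_bases_le_sum_digits hd0 hd2 hp n
  rw [Finset.sum_range_succ] at this
  rw [seqA_eq hd0 hd2 hp]
  linarith

lemma seqA_le (hd0 : ∀ n, 0 ≤ d n) (hd2 : ∀ n < 2, d n = 0) (hα : IsStochastic α)
    (hp : p ∈ tablesWith d α) (n : ℕ) : seqA d α n ≤ 1 - ∑ k ∈ Finset.range n, d k := by
  rw [seqA_eq hd0 hd2 hp]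
  have := sum_le_hasSum (Finset.range n) (fun j _ => hα.1 j) hα.2
  linarith

lemma seqA_succ (hd0 : ∀ n, 0 ≤ d n) (hd2 : ∀ n < 2, d n = 0) (hp : p ∈ tablesWith d α) (n : ℕ) :
    seqA d α (n + 1) = seqA d α n + α n - d n := by
  rw [seqA_eq hd0 hd2 hp, seqA_eq hd0 hd2 hp, Finset.sum_range_succ, Finset.sum_range_succ]
  ring

lemma seqP_succ {n : ℕ} (hn : firstIndex α + 1 ≤ n) :
    seqP d α (n + 1) = seqP d α n * (1 - d n / seqA d α n) :=
  Finset.prod_Ico_succ_top hn _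

lemma seqP_firstIndex_succ : seqP d α (firstIndex α + 1) = 1 := by simp [seqP]

lemma seqT_eq (j : ℕ) : seqT d α j = α j / seqP d α (j + 1) := by
  rw [seqT, seqP, Finset.Ico_add_one_right_eq_Icc]

lemma seqR_eq (n : ℕ) : seqR d α n = seqP d α n / seqA d α n := by
  rw [seqR, seqP]; ring

/-- If `A n = 0` the quotient is zero by convention, but then `0 ≤ d n ≤ A n` forces `d n = 0`, so
the identity survives. -/
lemma ratio_mul_seqA (hd0 : ∀ n, 0 ≤ d n) (hd2 : ∀ n < 2, d n = 0) (hp : p ∈ tablesWith d α)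
    (n : ℕ) : d n / seqA d α n * seqA d α n = d n := by
  by_cases h : seqA d α n = 0
  · have := le_seqA hd0 hd2 hp n
    rw [h] at this ⊢
    rw [mul_zero, le_antisymm this (hd0 n)]
  · exact div_mul_cancel₀ _ h

lemma ratio_le_one (hd0 : ∀ n, 0 ≤ d n) (hd2 : ∀ n < 2, d n = 0) (hp : p ∈ tablesWith d α)
    (n : ℕ) : d n / seqA d α n ≤ 1 :=
  div_le_one_of_le₀ (le_seqA hd0 hd2 hp n) ((hd0 n).trans (le_seqA hd0 hd2 hp n))

lemma seqP_nonneg (hd0 : ∀ n, 0 ≤ d n) (hd2 : ∀ n < 2, d n = 0) (hp : p ∈ tablesWith d α)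
    (n : ℕ) : 0 ≤ seqP d α n :=
  Finset.prod_nonneg fun k _ => sub_nonneg.2 (ratio_le_one hd0 hd2 hp k)

/-- With `D n = 1 - ∑_{k<n} d k` and `ρ = d n / A n`, induction gives `P (n+1) ≤ (1 - ρ) * D n ≤ D n
- ρ * A n = D (n+1)`, using `A n ≤ D n`. This forces `P n → 0`. -/
lemma seqP_le (hd0 : ∀ n, 0 ≤ d n) (hd2 : ∀ n < 2, d n = 0) (hα : IsStochastic α)
    (hp : p ∈ tablesWith d α) {n : ℕ} (hn : firstIndex α + 1 ≤ n) :
    seqP d α n ≤ 1 - ∑ k ∈ Finset.range n, d k := by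
  induction n, hn using Nat.le_induction with
  | base =>
    rw [seqP_firstIndex_succ, Finset.sum_eq_zero, sub_zero]
    intro k hk
    exact base_eq_zero_of_le_firstIndex hd0 hd2 hp (Nat.lt_succ_iff.1 (Finset.mem_range.1 hk))
  | succ n hn ih =>
    rw [seqP_succ hn, Finset.sum_range_succ]
    have h1 := ratio_mul_seqA hd0 hd2 hp n
    have h2 := ratio_le_one hd0 hd2 hp n
    have h3 := seqA_le hd0 hd2 hα hp n
    have h4 : 0 ≤ d n / seqA d α n :=
      div_nonneg (hd0 n) ((hd0 n).trans (le_seqA hd0 hd2 hp n))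
    nlinarith [mul_le_mul_of_nonneg_right ih (sub_nonneg.2 h2), mul_le_mul_of_nonneg_left h3 h4]

lemma base_mul_seqR {n : ℕ} (hn : firstIndex α + 1 ≤ n) :
    d n * seqR d α n = seqP d α n - seqP d α (n + 1) := by
  rw [seqP_succ hn, seqR_eq]
  ring

lemma seqR_nonneg (hd0 : ∀ n, 0 ≤ d n) (hd2 : ∀ n < 2, d n = 0) (hp : p ∈ tablesWith d α)
    (n : ℕ) : 0 ≤ seqR d α n := by
  rw [seqR_eq]
  exact div_nonneg (seqP_nonneg hd0 hd2 hp n) ((hd0 n).trans (le_seqA hd0 hd2 hp n))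

/-- The terms telescope as `P n - P (n+1)`, and nothing is left at infinity because `P n → 0`.
Multiplied by `t j`, this is the column condition of the table. -/
lemma hasSum_base_mul_seqR (hd0 : ∀ n, 0 ≤ d n) (hd2 : ∀ n < 2, d n = 0) (hd1 : HasSum d 1)
    (hα : IsStochastic α) (hp : p ∈ tablesWith d α) {j : ℕ} (hj : firstIndex α ≤ j) :
    HasSum (fun n => if j < n then d n * seqR d α n else 0) (seqP d α (j + 1)) := by
  rw [hasSum_iff_tendsto_nat_of_nonneg]
  swap
  · intro n
    split_ifs
    · exact mul_nonneg (hd0 n) (seqR_nonneg hd0 hd2 hp n)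
    · exact le_rfl
  have hlim : Tendsto (fun m => seqP d α m) atTop (𝓝 0) := by
    have h1 : Tendsto (fun m => 1 - ∑ k ∈ Finset.range m, d k) atTop (𝓝 0) := by
      simpa using hd1.tendsto_sum_nat.const_sub 1
    refine squeeze_zero' (Eventually.of_forall fun m => seqP_nonneg hd0 hd2 hp m) ?_ h1
    filter_upwards [eventually_ge_atTop (firstIndex α + 1)] with m hm
    exact seqP_le hd0 hd2 hα hp hm
  have h2 := hlim.const_sub (seqP d α (j + 1))
  rw [sub_zero] at h2
  refine h2.congr' ?_
  filter_upwards [eventually_ge_atTop (j + 1)] with m hm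
  induction m, hm using Nat.le_induction with
  | base =>
    rw [sub_self, Finset.sum_eq_zero]
    intro n hn
    rw [if_neg]
    simpa [Nat.lt_succ_iff] using hn
  | succ m hm ih =>
    rw [Finset.sum_range_succ, ← ih, if_pos (by omega), base_mul_seqR (by omega)]
    ring

lemma seqP_ne_zero_of_digit (hden : ∀ j, α j ≠ 0 → ∀ k ∈ Finset.Icc (firstIndex α + 1) j,
    seqA d α k ≠ 0 ∧ 1 - d k / seqA d α k ≠ 0) {j : ℕ} (hj : α j ≠ 0) : seqP d α (j + 1) ≠ 0 := by
  rw [seqP, Finset.Ico_add_one_right_eq_Icc, Finset.prod_ne_zero_iff]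
  exact fun k hk => (hden j hj k hk).2

/-- A vanishing factor at some `k < n` would, by `hden`, leave no digit of positive frequency from
`k` on. Then `A k = d k` says that the bases up to `k` already carry all the mass, contradicting `d
n ≠ 0`. -/
lemma seqP_ne_zero_of_base (hd0 : ∀ n, 0 ≤ d n) (hd2 : ∀ n < 2, d n = 0) (hd1 : HasSum d 1)
    (hα : IsStochastic α) (hp : p ∈ tablesWith d α)
    (hden : ∀ j, α j ≠ 0 → ∀ k ∈ Finset.Icc (firstIndex α + 1) j,
      seqA d α k ≠ 0 ∧ 1 - d k / seqA d α k ≠ 0) {n : ℕ} (hn : d n ≠ 0) : seqP d α n ≠ 0 := by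
  rw [seqP, Finset.prod_ne_zero_iff]
  intro k hk h0
  rw [Finset.mem_Ico] at hk
  have h1 : ∀ j, j ∉ Finset.range k → α j = 0 := by
    intro j hj
    by_contra h
    exact (hden j h k (by simp at hj ⊢; omega)).2 h0
  have h2 : ∑ j ∈ Finset.range k, α j = 1 := (hasSum_sum_of_ne_finset_zero h1).unique hα.2
  have h3 := ratio_mul_seqA hd0 hd2 hp k
  rw [← sub_eq_zero.1 h0, one_mul, seqA_eq hd0 hd2 hp, h2] at h3
  have h4 := sum_le_hasSum (insert n (Finset.range (k + 1))) (fun j _ => hd0 j) hd1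
  rw [Finset.sum_insert (by simp; omega), Finset.sum_range_succ] at h4
  exact hn (le_antisymm (by linarith) (hd0 n))

lemma seqT_eq_zero {j : ℕ} (hj : α j = 0) : seqT d α j = 0 := by rw [seqT, hj, zero_div]

lemma seqT_nonneg (hd0 : ∀ n, 0 ≤ d n) (hd2 : ∀ n < 2, d n = 0) (hα : IsStochastic α)
    (hp : p ∈ tablesWith d α) (j : ℕ) : 0 ≤ seqT d α j := by
  rw [seqT_eq]
  exact div_nonneg (hα.1 j) (seqP_nonneg hd0 hd2 hp _)

lemma seqP_mul_seqT (hden : ∀ j, α j ≠ 0 → ∀ k ∈ Finset.Icc (firstIndex α + 1) j,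
    seqA d α k ≠ 0 ∧ 1 - d k / seqA d α k ≠ 0) (j : ℕ) :
    seqP d α (j + 1) * seqT d α j = α j := by
  by_cases h : α j = 0
  · rw [seqT_eq_zero h, h, mul_zero]
  · rw [seqT_eq, mul_div_cancel₀ _ (seqP_ne_zero_of_digit hden h)]

/-- Passing from `n` to `n + 1` multiplies `A n` by `1 - d n / A n`, which removes `d n`, and adds
`P (n+1) * t n = α n`; this is the recursion of `A`. Divided by `A n`, the identity says that the
rows of the table sum to one. -/
lemma seqP_mul_sum_seqT (hd0 : ∀ n, 0 ≤ d n) (hd2 : ∀ n < 2, d n = 0)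
    (hp : p ∈ tablesWith d α) (hden : ∀ j, α j ≠ 0 → ∀ k ∈ Finset.Icc (firstIndex α + 1) j,
      seqA d α k ≠ 0 ∧ 1 - d k / seqA d α k ≠ 0) {n : ℕ} (hn : firstIndex α + 1 ≤ n)
    (hP : seqP d α n ≠ 0) :
    seqP d α n * ∑ j ∈ Finset.range n, seqT d α j = seqA d α n := by
  induction n, hn using Nat.le_induction with
  | base =>
    have h := seqP_mul_seqT hden (firstIndex α)
    rw [seqA_eq hd0 hd2 hp, Finset.sum_range_succ, Finset.sum_range_succ,
      Finset.sum_eq_zero (s := Finset.range (firstIndex α)) (f := seqT d α)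
        fun j hj => seqT_eq_zero (eq_zero_of_lt_firstIndex (Finset.mem_range.1 hj)),
      Finset.sum_eq_zero (s := Finset.range (firstIndex α))
        fun j hj => eq_zero_of_lt_firstIndex (Finset.mem_range.1 hj), zero_add, h,
      Finset.sum_eq_zero (s := Finset.range (firstIndex α + 1))
        fun k hk => base_eq_zero_of_le_firstIndex hd0 hd2 hp
          (Nat.lt_succ_iff.1 (Finset.mem_range.1 hk))]
    ring
  | succ n hn ih =>
    have h1 := ih (left_ne_zero_of_mul (seqP_succ (d := d) hn ▸ hP))
    have h2 := seqP_mul_seqT hden n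
    have h3 := ratio_mul_seqA hd0 hd2 hp n
    rw [Finset.sum_range_succ, mul_add, h2, seqA_succ hd0 hd2 hp, seqP_succ hn]
    linear_combination (1 - d n / seqA d α n) * h1 - h3

lemma seqT_pos (hd0 : ∀ n, 0 ≤ d n) (hd2 : ∀ n < 2, d n = 0) (hα : IsStochastic α)
    (hp : p ∈ tablesWith d α) (hden : ∀ j, α j ≠ 0 → ∀ k ∈ Finset.Icc (firstIndex α + 1) j,
      seqA d α k ≠ 0 ∧ 1 - d k / seqA d α k ≠ 0) {j : ℕ} (hj : α j ≠ 0) : 0 < seqT d α j := by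
  refine lt_of_le_of_ne (seqT_nonneg hd0 hd2 hα hp j) fun h => hj ?_
  rw [← seqP_mul_seqT hden j, ← h, mul_zero]

lemma seqR_pos (hd0 : ∀ n, 0 ≤ d n) (hd2 : ∀ n < 2, d n = 0) (hd1 : HasSum d 1)
    (hα : IsStochastic α) (hp : p ∈ tablesWith d α)
    (hden : ∀ j, α j ≠ 0 → ∀ k ∈ Finset.Icc (firstIndex α + 1) j,
      seqA d α k ≠ 0 ∧ 1 - d k / seqA d α k ≠ 0) {n : ℕ} (hn : d n ≠ 0) : 0 < seqR d α n := by
  rw [seqR_eq]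
  have h1 := (seqP_nonneg hd0 hd2 hp n).lt_of_ne'
    (seqP_ne_zero_of_base hd0 hd2 hd1 hα hp hden hn)
  have h2 := ((hd0 n).lt_of_ne' hn).trans_le (le_seqA hd0 hd2 hp n)
  positivity

/-- The explicit weights define a table that is compatible with `d` and `α`. -/
theorem factorTable_mem_tablesWith (hd0 : ∀ n, 0 ≤ d n) (hd2 : ∀ n < 2, d n = 0)
    (hd1 : HasSum d 1) (hα : IsStochastic α) (hp : p ∈ tablesWith d α)
    (hden : ∀ j, α j ≠ 0 → ∀ k ∈ Finset.Icc (firstIndex α + 1) j,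
      seqA d α k ≠ 0 ∧ 1 - d k / seqA d α k ≠ 0) :
    factorTable d (seqT d α) (seqR d α) ∈ tablesWith d α := by
  constructor
  · intro n hn
    -- A row of weight zero only has to be a probability vector; the table uses the point mass at
    -- `0`.
    by_cases h : d n = 0
    · refine ⟨fun j => ?_, fun j hj => ?_, ?_⟩
      · simp only [factorTable, if_pos h]
        split_ifs <;> norm_num
      · simp only [factorTable, if_pos h]
        rw [if_neg (by omega)]
      · simp only [factorTable, if_pos h]
        rw [Finset.sum_ite_eq', if_pos (Finset.mem_range.2 (by omega))]
    · refine ⟨fun j => ?_, fun j hj => ?_, ?_⟩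
      · simp only [factorTable, if_neg h]
        split_ifs
        · exact mul_nonneg (seqT_nonneg hd0 hd2 hα hp j) (seqR_nonneg hd0 hd2 hp n)
        · exact le_rfl
      · simp only [factorTable, if_neg h]
        rw [if_neg (not_lt.2 hj)]
      · have h1 : ∀ j ∈ Finset.range n, factorTable d (seqT d α) (seqR d α) n j =
            seqT d α j * seqR d α n := by
          intro j hj
          rw [factorTable, if_neg h, if_pos (Finset.mem_range.1 hj)]
        have hfn : firstIndex α + 1 ≤ n := by
          by_contra hc
          exact h (base_eq_zero_of_le_firstIndex hd0 hd2 hp (by omega))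
        have hP := seqP_ne_zero_of_base hd0 hd2 hd1 hα hp hden h
        have h2 := seqP_mul_sum_seqT hd0 hd2 hp hden hfn hP
        have h3 := ((hd0 n).lt_of_ne' h).trans_le (le_seqA hd0 hd2 hp n)
        rw [Finset.sum_congr rfl h1, ← Finset.sum_mul, seqR_eq, ← mul_div_assoc, mul_comm, h2,
          div_self h3.ne']
  · intro j
    by_cases h : α j = 0
    · have h0 : (fun n => d n * factorTable d (seqT d α) (seqR d α) n j) = fun _ => 0 := by
        funext n
        by_cases hn : d n = 0 <;> simp [factorTable, seqT_eq_zero h, hn]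
      rw [h0, h]
      exact hasSum_zero
    · have hj : firstIndex α ≤ j := Nat.sInf_le h
      have h1 := (hasSum_base_mul_seqR hd0 hd2 hd1 hα hp hj).mul_right (seqT d α j)
      rw [seqP_mul_seqT hden] at h1
      refine h1.congr_fun fun n => ?_
      by_cases hn : d n = 0
      · simp [hn]
      · rw [factorTable, if_neg hn]
        split_ifs <;> ring

end

/-! ### Entropy of a product table -/

lemma rowEntropy_nonneg {p : ℕ → ℕ → ℝ} (hp : p ∈ tables) {n : ℕ} (hn : 2 ≤ n) :
    0 ≤ rowEntropy p n := by
  refine Finset.sum_nonneg fun j hj => Real.negMulLog_nonneg ((hp n hn).1 j) ?_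
  rw [← (hp n hn).2.2]
  exact Finset.single_le_sum (f := p n) (fun i _ => (hp n hn).1 i) hj

/-- Comparison with the uniform law: `log x ≤ x - 1` at `x = 1 / (n * p n j)`, summed against `p n
j`. It makes the total entropy summable. -/
lemma rowEntropy_le_log {p : ℕ → ℕ → ℝ} (hp : p ∈ tables) {n : ℕ} (hn : 2 ≤ n) :
    rowEntropy p n ≤ Real.log n := by
  have hn0 : (0 : ℝ) < n := by positivity
  have h1 : ∀ j ∈ Finset.range n,
      Real.negMulLog (p n j) ≤ p n j * Real.log n + (1 / n - p n j) := by
    intro j _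
    rcases ((hp n hn).1 j).eq_or_lt with h | h
    · rw [← h]
      simp
    · have h2 := Real.log_le_sub_one_of_pos (x := 1 / (n * p n j)) (by positivity)
      rw [one_div, Real.log_inv, Real.log_mul hn0.ne' h.ne'] at h2
      have h3 := mul_le_mul_of_nonneg_left h2 h.le
      have h4 : p n j * ((n * p n j)⁻¹ - 1) = 1 / n - p n j := by field_simp
      rw [h4] at h3
      rw [Real.negMulLog]
      linarith
  refine (Finset.sum_le_sum h1).trans (le_of_eq ?_)
  rw [Finset.sum_add_distrib, ← Finset.sum_mul, Finset.sum_sub_distrib, (hp n hn).2.2]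
  simp [hn0.ne']

/-- The entropy of a table of product form. -/
theorem hasSum_entropy_factorTable {d α t r : ℕ → ℝ} (hd0 : ∀ n, 0 ≤ d n)
    (hd2 : ∀ n < 2, d n = 0) (hlog : Summable fun n : ℕ => d n * Real.log n)
    (hr : ∀ n, d n ≠ 0 → 0 < r n)
    (hp : factorTable d t r ∈ tablesWith d α) (hsum : Summable fun j => α j * Real.log (t j)) :
    (Summable fun n => d n * Real.log (r n)) ∧
      HasSum (fun n => d n * rowEntropy (factorTable d t r) n)
        (-(∑' j, α j * Real.log (t j) + ∑' n, d n * Real.log (r n))) := by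
  set p := factorTable d t r with hpdef
  have hnn : ∀ k j, 0 ≤ d k * p k j := by
    intro k j
    by_cases hk : 2 ≤ k
    · exact mul_nonneg (hd0 k) ((hp.1 k hk).1 j)
    · simp [hd2 k (not_le.1 hk)]
  have hH : Summable fun n => d n * rowEntropy p n := by
    refine Summable.of_nonneg_of_le (fun n => ?_) (fun n => ?_) hlog
    · by_cases hn : 2 ≤ n
      · exact mul_nonneg (hd0 n) (rowEntropy_nonneg hp.1 hn)
      · simp [hd2 n (not_le.1 hn)]
    · by_cases hn : 2 ≤ n
      · exact mul_le_mul_of_nonneg_left (rowEntropy_le_log hp.1 hn) (hd0 n)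
      · simp [hd2 n (not_le.1 hn)]
  -- The columns sum in absolute value to `|α j log t j|`, so the double series may be summed by
  -- rows instead.
  have hS : Summable fun v : ℕ × ℕ => d v.2 * p v.2 v.1 * Real.log (t v.1) := by
    rw [← summable_norm_iff]
    have hcol : ∀ j, HasSum (fun n => ‖d n * p n j * Real.log (t j)‖) (‖α j * Real.log (t j)‖) := by
      intro j
      have h1 := (hp.2 j).mul_right |Real.log (t j)|
      have h2 : 0 ≤ α j := (hp.2 j).nonneg fun n => hnn n j
      rw [norm_mul, Real.norm_of_nonneg h2, Real.norm_eq_abs]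
      refine h1.congr_fun fun n => ?_
      rw [norm_mul, Real.norm_of_nonneg (hnn n j), Real.norm_eq_abs]
    refine (summable_prod_of_nonneg fun v => norm_nonneg _).2 ⟨fun j => (hcol j).summable, ?_⟩
    simp_rw [fun j => (hcol j).tsum_eq]
    exact hsum.norm
  have hT1 : ∑' v : ℕ × ℕ, d v.2 * p v.2 v.1 * Real.log (t v.1) = ∑' j, α j * Real.log (t j) :=
    (hS.hasSum.prod_fiberwise fun j => (hp.2 j).mul_right (Real.log (t j))).tsum_eq.symm
  set K : ℕ → ℝ := fun n => ∑ j ∈ Finset.range n, d n * p n j * Real.log (t j) with hK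
  have hrow : ∀ n, HasSum (fun j => d n * p n j * Real.log (t j)) (K n) := by
    intro n
    refine hasSum_sum_of_ne_finset_zero fun j hj => ?_
    by_cases hn : 2 ≤ n
    · rw [(hp.1 n hn).2.1 j (by simpa using hj)]
      ring
    · rw [hd2 n (not_le.1 hn)]
      ring
  have hT2 : HasSum K (∑' j, α j * Real.log (t j)) := by
    rw [← hT1]
    have h1 := (Equiv.prodComm ℕ ℕ).hasSum_iff.2 hS.hasSum
    exact h1.prod_fiberwise hrow
  have hid : ∀ n, d n * rowEntropy p n = -K n - d n * Real.log (r n) := by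
    intro n
    by_cases h : d n = 0
    · simp [hK, h]
    have hn : 2 ≤ n := by
      by_contra hc
      exact h (hd2 n (not_le.1 hc))
    have h1 : ∀ j ∈ Finset.range n,
        Real.negMulLog (p n j) = -(p n j * Real.log (t j)) - p n j * Real.log (r n) := by
      intro j hj
      have hpj : p n j = t j * r n := by
        rw [hpdef, factorTable, if_neg h, if_pos (Finset.mem_range.1 hj)]
      by_cases ht : t j = 0
      · rw [hpj, ht]
        simp
      · rw [Real.negMulLog, hpj, Real.log_mul ht (hr n h).ne']
        ring
    rw [rowEntropy, Finset.sum_congr rfl h1, Finset.sum_sub_distrib, ← Finset.sum_mul,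
      (hp.1 n hn).2.2, Finset.sum_neg_distrib, hK, one_mul, mul_sub, mul_neg, Finset.mul_sum]
    simp only [mul_assoc]
  -- Convergence of the second series comes from here: it is the difference of the row sums `-K` and
  -- the entropies, both summable.
  have hR : Summable fun n => d n * Real.log (r n) := by
    refine (hT2.summable.neg.sub hH).congr fun n => ?_
    rw [hid n]
    ring
  refine ⟨hR, ?_⟩
  have := hT2.neg.sub hR.hasSum
  rw [neg_add, ← sub_eq_add_neg]
  exact this.congr_fun hid

/-! ### Upper bound from the digit cost -/

/-- The cost of the digit `j` in base `k`: minus the logarithm of the weight `t j * r k`, replaced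
by a large cost `C` where this weight vanishes, and `log k` for the large bases `k ≥ N`. -/
def digitCost (d α t r : ℕ → ℝ) (C : ℝ) (N k j : ℕ) : ℝ :=
  if k < N then
    (if α j = 0 then C else -Real.log (t j)) + (if d k = 0 then C else -Real.log (r k))
  else Real.log k

section

variable {d α t r : ℕ → ℝ}

/-- As `C → ∞` the weights tend to table entries or to zero, with total at most one, and only
finitely many bases lie below `N`; for the others the weights are uniform. The slack `η` absorbs the
error at a finite `C`. -/
lemma exists_sum_exp_digitCost_le (ht : ∀ j, α j ≠ 0 → 0 < t j) (hr : ∀ n, d n ≠ 0 → 0 < r n)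
    (hp : factorTable d t r ∈ tablesWith d α) (N : ℕ) {η : ℝ} (hη : 0 < η) :
    ∃ C, ∀ k, 2 ≤ k → ∑ j ∈ Finset.range k, Real.exp (-digitCost d α t r C N k j) ≤ Real.exp η := by
  have hη1 : 1 < Real.exp η := Real.one_lt_exp_iff.2 hη
  have key : ∀ k ∈ Finset.range N, ∀ᶠ C in atTop, 2 ≤ k →
      ∑ j ∈ Finset.range k, Real.exp (-digitCost d α t r C N k j) ≤ Real.exp η := by
    intro k hk
    by_cases hk2 : 2 ≤ k
    swap
    · exact Eventually.of_forall fun C h => absurd h hk2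
    have hterm : ∀ j ∈ Finset.range k,
        Tendsto (fun C => Real.exp (-digitCost d α t r C N k j)) atTop
          (𝓝 (if d k = 0 ∨ α j = 0 then 0 else factorTable d t r k j)) := by
      intro j hj
      simp only [digitCost, if_pos (Finset.mem_range.1 hk)]
      by_cases h1 : d k = 0 <;> by_cases h2 : α j = 0 <;> simp only [h1, h2, if_true, if_false,
        or_true, or_false]
      · exact Real.tendsto_exp_neg_atTop_nhds_zero.comp (tendsto_id.atTop_add_atTop tendsto_id)
      · exact Real.tendsto_exp_neg_atTop_nhds_zero.comp
          (tendsto_atTop_add_const_left _ _ tendsto_id)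
      · exact Real.tendsto_exp_neg_atTop_nhds_zero.comp
          (tendsto_atTop_add_const_right _ _ tendsto_id)
      · rw [factorTable, if_neg h1, if_pos (Finset.mem_range.1 hj), neg_add, neg_neg, neg_neg,
          Real.exp_add, Real.exp_log (ht j h2), Real.exp_log (hr k h1)]
        exact tendsto_const_nhds
    have hlim := tendsto_finsetSum _ hterm
    have hle : ∑ j ∈ Finset.range k, (if d k = 0 ∨ α j = 0 then 0 else factorTable d t r k j) ≤
        1 := by
      rw [← (hp.1 k hk2).2.2]
      refine Finset.sum_le_sum fun j _ => ?_
      split_ifs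
      · exact (hp.1 k hk2).1 j
      · exact le_rfl
    filter_upwards [hlim.eventually_lt_const (hle.trans_lt hη1)] with C hC _
    exact hC.le
  obtain ⟨C, hC⟩ := ((Finset.eventually_all _).2 key).exists
  refine ⟨C, fun k hk2 => ?_⟩
  by_cases hk : k < N
  · exact hC k (Finset.mem_range.2 hk) hk2
  · have hk0 : (0 : ℝ) < k := by positivity
    simp only [digitCost, if_neg hk, Real.exp_neg, Real.exp_log hk0, Finset.sum_const,
      Finset.card_range, nsmul_eq_mul]
    rw [mul_inv_cancel₀ hk0.ne']
    exact hη1.le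

/-- The asymptotic bound for the mean cost of digit sequences with digit frequencies `α`. -/
def costBound (d α t r : ℕ → ℝ) (N : ℕ) : ℝ :=
  (∑' n : ℕ, d n * Real.log n) - ∑ k ∈ Finset.range N, d k * Real.log k
    - ∑ k ∈ Finset.range N, d k * Real.log (r k)
    - ∑ j ∈ Finset.range N, α j * Real.log (t j)
    + ∑ j ∈ Finset.range N, |Real.log (t j)| * min (α j) (1 - ∑ k ∈ Finset.range N, d k)

lemma tendsto_costBound (hd0 : ∀ n, 0 ≤ d n) (hd1 : HasSum d 1) (hα0 : ∀ j, 0 ≤ α j)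
    (hlog : Summable fun n : ℕ => d n * Real.log n)
    (hr : Summable fun n => d n * Real.log (r n)) (ht : Summable fun j => α j * Real.log (t j)) :
    Tendsto (costBound d α t r) atTop
      (𝓝 (-(∑' j, α j * Real.log (t j) + ∑' n, d n * Real.log (r n)))) := by
  have hD : Tendsto (fun N => 1 - ∑ k ∈ Finset.range N, d k) atTop (𝓝 0) := by
    simpa using hd1.tendsto_sum_nat.const_sub 1
  have hD0 : ∀ N, 0 ≤ 1 - ∑ k ∈ Finset.range N, d k := fun N =>
    sub_nonneg.2 (sum_le_hasSum _ (fun k _ => hd0 k) hd1)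
  have hlast : Tendsto (fun N => ∑ j ∈ Finset.range N,
      |Real.log (t j)| * min (α j) (1 - ∑ k ∈ Finset.range N, d k)) atTop (𝓝 0) := by
    -- The bound `min (α j) _ ≤ α j` provides the dominating series `|α j log t j|`, and the other
    -- entry of the minimum tends to zero.
    have h := tendsto_tsum_of_dominated_convergence (𝓕 := atTop)
      (f := fun N j => if j < N then
        |Real.log (t j)| * min (α j) (1 - ∑ k ∈ Finset.range N, d k) else 0)
      (g := fun _ => (0 : ℝ)) ht.norm (fun j => ?_) (Eventually.of_forall fun N j => ?_)
    · rw [tsum_zero] at h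
      refine h.congr fun N => ?_
      rw [tsum_eq_sum (s := Finset.range N) fun j hj => if_neg (by simpa using hj)]
      exact Finset.sum_congr rfl fun j hj => if_pos (Finset.mem_range.1 hj)
    · have h1 := hD.const_mul |Real.log (t j)|
      rw [mul_zero] at h1
      refine squeeze_zero (fun N => ?_) (fun N => ?_) h1
      · split_ifs
        · exact mul_nonneg (abs_nonneg _) (le_min (hα0 j) (hD0 N))
        · exact le_rfl
      · split_ifs
        · exact mul_le_mul_of_nonneg_left (min_le_right _ _) (abs_nonneg _)
        · exact mul_nonneg (abs_nonneg _) (hD0 N)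
    · rw [norm_mul, Real.norm_of_nonneg (hα0 j), Real.norm_eq_abs, Real.norm_eq_abs]
      split_ifs
      · rw [abs_mul, abs_abs, abs_of_nonneg (le_min (hα0 j) (hD0 N)), mul_comm]
        exact mul_le_mul_of_nonneg_right (min_le_left _ _) (abs_nonneg _)
      · rw [abs_zero]
        exact mul_nonneg (hα0 j) (abs_nonneg _)
  have := (((tendsto_const_nhds (x := ∑' n : ℕ, d n * Real.log n)).sub
    hlog.hasSum.tendsto_sum_nat).sub hr.hasSum.tendsto_sum_nat).sub ht.hasSum.tendsto_sum_nat
    |>.add hlast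
  have e : -(∑' j, α j * Real.log (t j) + ∑' n, d n * Real.log (r n)) =
      (∑' n : ℕ, d n * Real.log n) - (∑' n : ℕ, d n * Real.log n)
        - (∑' n, d n * Real.log (r n)) - (∑' j, α j * Real.log (t j)) + 0 := by ring
  rw [e]
  exact this

/-- Joint frequencies of bases and digits are unknown, so the digit cost is averaged over all digits
below `N`. The places with a large base and a small digit are thereby counted wrongly; for each
digit their number is at most the smaller of its own count and the count of large bases. -/
lemma eventually_sum_digitCost_le {b : ℕ → ℕ} (hd0 : ∀ n, 0 ≤ d n) (hd1 : HasSum d 1)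
    (hd : IsBaseFrequency b d)
    (hmean : Tendsto (fun n => (∑ i ∈ Finset.range n, Real.log (b i)) / n) atTop
      (𝓝 (∑' n : ℕ, d n * Real.log n)))
    {ε : ℕ → ℕ} (hv : ∀ i, ε i < b i)
    (hε : ∀ j, Tendsto (fun n : ℕ => (digitCount ε j n : ℝ) / n) atTop (𝓝 (α j)))
    (C : ℝ) (N : ℕ) {c : ℝ} (hc : costBound d α t r N < c) :
    ∀ᶠ n : ℕ in atTop, ∑ i ∈ Finset.range n, digitCost d α t r C N (b i) (ε i) ≤ n * c := by
  set F : ℕ → ℝ := fun j => if α j = 0 then C else -Real.log (t j) with hF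
  set G : ℕ → ℝ := fun k => if d k = 0 then C else -Real.log (r k) with hG
  have l1 := tendsto_average_of_frequency hd (Finset.range N) (fun k => Real.log k)
  have l2 := tendsto_average_of_frequency hd (Finset.range N) G
  have l3 := tendsto_average_of_frequency hε (Finset.range N) F
  have l4 : Tendsto (fun n : ℕ => ∑ j ∈ Finset.range N, |F j| * min ((digitCount ε j n : ℝ) / n)
      ((((Finset.range n).filter (fun i => N ≤ b i)).card : ℝ) / n)) atTop
      (𝓝 (∑ j ∈ Finset.range N, |F j| * min (α j) (1 - ∑ k ∈ Finset.range N, d k))) :=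
    tendsto_finsetSum _ fun j _ => ((hε j).min (tendsto_tail_frequency hd N)).const_mul _
  have hD0 : 0 ≤ 1 - ∑ k ∈ Finset.range N, d k :=
    sub_nonneg.2 (sum_le_hasSum _ (fun k _ => hd0 k) hd1)
  have hlim := (((hmean.sub l1).add l2).add l3).add l4
  have hval : (∑' n : ℕ, d n * Real.log n) - ∑ k ∈ Finset.range N, d k * Real.log k
      + ∑ k ∈ Finset.range N, d k * G k + ∑ j ∈ Finset.range N, α j * F j
      + ∑ j ∈ Finset.range N, |F j| * min (α j) (1 - ∑ k ∈ Finset.range N, d k) =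
      costBound d α t r N := by
    -- The arbitrary cost `C` leaves no trace in the limit: it sits only on symbols of frequency
    -- zero.
    have e1 : ∀ k, d k * G k = -(d k * Real.log (r k)) := fun k => by
      by_cases h : d k = 0 <;> simp [hG, h]
    have e2 : ∀ j, α j * F j = -(α j * Real.log (t j)) := fun j => by
      by_cases h : α j = 0 <;> simp [hF, h]
    have e3 : ∀ j, |F j| * min (α j) (1 - ∑ k ∈ Finset.range N, d k) =
        |Real.log (t j)| * min (α j) (1 - ∑ k ∈ Finset.range N, d k) := fun j => by
      by_cases h : α j = 0
      · simp only [h, min_eq_left hD0, mul_zero]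
      · simp [hF, h]
    simp only [e1, e2, e3, Finset.sum_neg_distrib]
    rw [costBound]
    ring
  rw [hval] at hlim
  filter_upwards [hlim.eventually_lt_const hc, eventually_gt_atTop 0] with n hn hn0
  have hn' : (0 : ℝ) < n := by exact_mod_cast hn0
  rw [← sub_div, ← add_div, ← add_div] at hn
  have hmin : ∀ j, (digitCount ε j n : ℝ) / n ⊓
      ((((Finset.range n).filter (fun i => N ≤ b i)).card : ℝ) / n) =
      ((digitCount ε j n : ℝ) ⊓ (((Finset.range n).filter (fun i => N ≤ b i)).card : ℝ)) / n :=
    fun j => (min_div_div_right hn'.le _ _)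
  simp only [hmin, ← mul_div_assoc] at hn
  rw [← Finset.sum_div, ← add_div, div_lt_iff₀' hn'] at hn
  refine le_trans ?_ hn.le
  have hcross : ∑ i ∈ Finset.range n, (if N ≤ b i ∧ ε i < N then |F (ε i)| else 0) ≤
      ∑ j ∈ Finset.range N, |F j| * ((digitCount ε j n : ℝ) ⊓
        (((Finset.range n).filter (fun i => N ≤ b i)).card : ℝ)) := by
    have h1 : ∀ i, (if N ≤ b i ∧ ε i < N then |F (ε i)| else 0) =
        ∑ j ∈ Finset.range N, if N ≤ b i ∧ ε i = j then |F j| else 0 := by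
      intro i
      by_cases h : N ≤ b i
      · simp only [h, true_and]
        rw [Finset.sum_ite_eq]
        simp
      · simp [h]
    simp_rw [h1]
    rw [Finset.sum_comm]
    refine Finset.sum_le_sum fun j _ => ?_
    rw [← Finset.sum_filter, Finset.sum_const, nsmul_eq_mul, mul_comm]
    refine mul_le_mul_of_nonneg_left (le_min ?_ ?_) (abs_nonneg _)
    · rw [digitCount, Nat.cast_le]
      exact Finset.card_le_card (Finset.monotone_filter_right _ fun i _ h => h.2)
    · rw [Nat.cast_le]
      exact Finset.card_le_card (Finset.monotone_filter_right _ fun i _ h => h.1)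
  refine le_trans ?_ (add_le_add_right hcross _)
  rw [← Finset.sum_sub_distrib, ← Finset.sum_add_distrib, ← Finset.sum_add_distrib,
    ← Finset.sum_add_distrib]
  refine Finset.sum_le_sum fun i _ => ?_
  simp only [Finset.mem_range]
  by_cases h : b i < N
  · have h' : ε i < N := (hv i).trans h
    simp only [digitCost, h, h', if_true, not_le.2 h, false_and, if_false, hF, hG]
    linarith
  · rw [digitCost, if_neg h, if_neg h, if_neg h]
    by_cases h' : ε i < N
    · rw [if_pos h', if_pos ⟨not_lt.1 h, h'⟩]
      linarith [neg_abs_le (F (ε i))]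
    · rw [if_neg h', if_neg fun h2 => h' h2.2]
      linarith

/-- Upper bound for the dimension of the level set. -/
theorem dimH_levelSet_le {b : ℕ → ℕ} (hb : ∀ i, 2 ≤ b i) (hd0 : ∀ n, 0 ≤ d n)
    (hd : IsBaseFrequency b d) (hd1 : HasSum d 1)
    (hlog : Summable fun n : ℕ => d n * Real.log n) (hL0 : 0 < ∑' n : ℕ, d n * Real.log n)
    (hmean : Tendsto (fun n => (∑ i ∈ Finset.range n, Real.log (b i)) / n) atTop
      (𝓝 (∑' n : ℕ, d n * Real.log n)))
    (hα0 : ∀ j, 0 ≤ α j) (ht : ∀ j, α j ≠ 0 → 0 < t j) (hr : ∀ n, d n ≠ 0 → 0 < r n)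
    (hp : factorTable d t r ∈ tablesWith d α)
    (hsr : Summable fun n => d n * Real.log (r n)) (hst : Summable fun j => α j * Real.log (t j)) :
    dimH (levelSet b α) ≤ ENNReal.ofReal
      (-(∑' j, α j * Real.log (t j) + ∑' n, d n * Real.log (r n)) /
        ∑' n : ℕ, d n * Real.log n) := by
  set h := -(∑' j, α j * Real.log (t j) + ∑' n, d n * Real.log (r n)) with hh
  set L := ∑' n : ℕ, d n * Real.log n with hL
  have key : ∀ e > 0, dimH (levelSet b α) ≤ ENNReal.ofReal (((h + e) + e) / L) := by
    intro e he
    obtain ⟨N, hN⟩ := ((tendsto_costBound hd0 hd1 hα0 hlog hsr hst).eventually_lt_const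
      (show -(∑' j, α j * Real.log (t j) + ∑' n, d n * Real.log (r n)) < h + e by linarith)).exists
    obtain ⟨C, hC⟩ := exists_sum_exp_digitCost_le ht hr hp N he
    refine (dimH_mono ?_).trans (dimH_le_of_cost hb hL0 hmean
      (Ψ := fun i j => digitCost d α t r C N (b i) j) (fun i => hC (b i) (hb i))
      (E := {ε | (∀ i, ε i < b i) ∧
        ∀ j, Tendsto (fun n : ℕ => (digitCount ε j n : ℝ) / n) atTop (𝓝 (α j))})
      fun ε hε => eventually_sum_digitCost_le hd0 hd1 hd hmean hε.1 hε.2 C N hN)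
    rintro x ⟨-, ε, hx, hε⟩
    exact ⟨ε, ⟨hx.1, hε⟩, hx⟩
  have hcont : Tendsto (fun e : ℝ => ENNReal.ofReal (((h + e) + e) / L)) (𝓝[>] 0)
      (𝓝 (ENNReal.ofReal (((h + 0) + 0) / L))) := by
    refine (ENNReal.tendsto_ofReal (Continuous.tendsto ?_ 0)).mono_left nhdsWithin_le_nhds
    fun_prop
  rw [add_zero, add_zero] at hcont
  exact ge_of_tendsto hcont (eventually_mem_nhdsWithin.mono key)

end

/-! ### Equality of the bounds -/

/-- The dimension of the level set, in terms of sums over all indices. -/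
theorem dimH_levelSet_eq (b : ℕ → ℕ) (hb : ∀ i, 2 ≤ b i)
    (d : ℕ → ℝ) (hd : IsBaseFrequency b d) (hd1 : HasSum d 1)
    (hlog : Summable (fun n : ℕ => d n * Real.log n))
    (hmean : Tendsto (fun n : ℕ => (∑ i ∈ Finset.range n, Real.log (b i)) / n) atTop
      (𝓝 (∑' n : ℕ, d n * Real.log n)))
    (α : ℕ → ℝ) (hα : IsStochastic α) {p : ℕ → ℕ → ℝ} (hp : p ∈ tablesWith d α)
    (hden : ∀ j, α j ≠ 0 → ∀ k ∈ Finset.Icc (firstIndex α + 1) j,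
      seqA d α k ≠ 0 ∧ 1 - d k / seqA d α k ≠ 0)
    (hsum : Summable (fun j : ℕ => α j * Real.log (seqT d α j))) :
    (∀ k ≤ firstIndex α, d k = 0) ∧
    Summable (fun i : ℕ => d i * Real.log (seqR d α i)) ∧
    ((dimH (levelSet b α) : ENNReal) : EReal) =
      ((-(∑' j, α j * Real.log (seqT d α j) + ∑' i, d i * Real.log (seqR d α i)) /
          ∑' n : ℕ, d n * Real.log n : ℝ) : EReal) := by
  have hd0 : ∀ n, 0 ≤ d n := fun n =>
    ge_of_tendsto' (hd n) fun m => by positivity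
  have hd2 : ∀ n < 2, d n = 0 := fun n hn => hd.eq_zero_of_lt_two hb hn
  have hL0 : 0 < ∑' n : ℕ, d n * Real.log n := by
    refine (Real.log_pos one_lt_two).trans_le (ge_of_tendsto hmean ?_)
    filter_upwards [eventually_gt_atTop 0] with n hn
    have hn' : (0 : ℝ) < n := by exact_mod_cast hn
    rw [le_div_iff₀ hn']
    have := Finset.card_nsmul_le_sum (Finset.range n) (fun i => Real.log (b i)) (Real.log 2)
      fun i _ => Real.log_le_log two_pos (by exact_mod_cast hb i)
    rw [Finset.card_range, nsmul_eq_mul] at this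
    linarith
  have hmem := factorTable_mem_tablesWith hd0 hd2 hd1 hα hp hden
  have hr : ∀ n, d n ≠ 0 → 0 < seqR d α n := fun n hn => seqR_pos hd0 hd2 hd1 hα hp hden hn
  obtain ⟨hsr, hent⟩ := hasSum_entropy_factorTable hd0 hd2 hlog hr hmem hsum
  refine ⟨fun k hk => base_eq_zero_of_le_firstIndex hd0 hd2 hp hk, hsr, ?_⟩
  have hle := dimH_levelSet_le hb hd0 hd hd1 hlog hL0 hmean hα.1
    (fun j hj => seqT_pos hd0 hd2 hα hp hden hj) hr hmem hsr hsum
  set h := -(∑' j, α j * Real.log (seqT d α j) + ∑' i, d i * Real.log (seqR d α i)) with hh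
  set L := ∑' n : ℕ, d n * Real.log n with hL
  have hh0 : 0 ≤ h := hent.nonneg fun n => by
    by_cases hn : 2 ≤ n
    · exact mul_nonneg (hd0 n) (rowEntropy_nonneg hmem.1 hn)
    · simp [hd2 n (not_le.1 hn)]
  have hge : ENNReal.ofReal (h / L) ≤ dimH (levelSet b α) := by
    refine le_of_forall_lt fun a ha => ?_
    obtain ⟨s, hs1, hs2⟩ := ENNReal.lt_iff_exists_nnreal_btwn.1 ha
    rw [← ENNReal.ofReal_coe_nnreal, ENNReal.ofReal_lt_ofReal_iff_of_nonneg s.coe_nonneg,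
      lt_div_iff₀ hL0] at hs2
    obtain ⟨N, hN⟩ := (hent.tendsto_sum_nat.eventually_const_lt hs2).exists
    exact hs1.trans_le (le_dimH_levelSet_of_lt_entropy hb hd hd1 hmean hL0 hmem hN)
  -- The real quotient is not cut off by `ENNReal.ofReal`, since `h` is a sum of nonnegative
  -- entropies.
  rw [le_antisymm hle hge, EReal.coe_ennreal_ofReal, max_eq_left (div_nonneg hh0 hL0.le)]

end CantorSeries

end

theorem mainTheorem1 (b : ℕ → ℕ) (hb : ∀ i, 2 ≤ b i)
    (d : ℕ → ℝ) (hd : CantorSeries.IsBaseFrequency b d) (hd1 : HasSum d 1)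
    (hlog : Summable (fun n : ℕ => d n * Real.log n))
    (hmean : Tendsto (fun n : ℕ => (∑ i ∈ Finset.range n, Real.log (b i)) / n) atTop
      (𝓝 (∑' n : ℕ, d n * Real.log n)))
    (α : ℕ → ℝ) (hα : CantorSeries.IsStochastic α)
    (hπ : (CantorSeries.tablesWith d α).Nonempty)
    (hden : ∀ j, α j ≠ 0 → ∀ k ∈ Finset.Icc (CantorSeries.firstIndex α + 1) j,
      CantorSeries.seqA d α k ≠ 0 ∧ 1 - d k / CantorSeries.seqA d α k ≠ 0)
    (hsum : Summable (fun j : ℕ => α (CantorSeries.firstIndex α + j) *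
      Real.log (CantorSeries.seqT d α (CantorSeries.firstIndex α + j)))) :
    Summable (fun i : ℕ => d (CantorSeries.firstIndex α + 1 + i) *
      Real.log (CantorSeries.seqR d α (CantorSeries.firstIndex α + 1 + i))) ∧
    ((dimH (CantorSeries.levelSet b α) : ENNReal) : EReal) =
      ((-((∑' j : ℕ, α (CantorSeries.firstIndex α + j) *
              Real.log (CantorSeries.seqT d α (CantorSeries.firstIndex α + j))) +
            ∑' i : ℕ, d (CantorSeries.firstIndex α + 1 + i) *
              Real.log (CantorSeries.seqR d α (CantorSeries.firstIndex α + 1 + i))) /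
          ∑' n : ℕ, d n * Real.log n : ℝ) : EReal) := by
  obtain ⟨p, hp⟩ := hπ
  have hcomm1 : (fun j : ℕ => α (CantorSeries.firstIndex α + j) *
      Real.log (CantorSeries.seqT d α (CantorSeries.firstIndex α + j))) =
      fun j : ℕ => α (j + CantorSeries.firstIndex α) *
        Real.log (CantorSeries.seqT d α (j + CantorSeries.firstIndex α)) := by
    funext j
    rw [add_comm]
  have hcomm2 : (fun i : ℕ => d (CantorSeries.firstIndex α + 1 + i) *
      Real.log (CantorSeries.seqR d α (CantorSeries.firstIndex α + 1 + i))) =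
      fun i : ℕ => d (i + (CantorSeries.firstIndex α + 1)) *
        Real.log (CantorSeries.seqR d α (i + (CantorSeries.firstIndex α + 1))) := by
    funext i
    rw [add_comm i]
  rw [hcomm1] at hsum ⊢
  rw [hcomm2]
  have hsum' := (summable_nat_add_iff (f := fun j => α j * Real.log (CantorSeries.seqT d α j))
    (CantorSeries.firstIndex α)).1 hsum
  obtain ⟨hd0, hsr, hdim⟩ :=
    CantorSeries.dimH_levelSet_eq b hb d hd hd1 hlog hmean α hα hp hden hsum'
  refine ⟨(summable_nat_add_iff (f := fun i => d i * Real.log (CantorSeries.seqR d α i)) _).2 hsr,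
    ?_⟩
  -- The shifted series equal the full ones: `α` vanishes below `j₀`, and `d` vanishes up to and
  -- including `j₀`.
  have e1 := hsum'.sum_add_tsum_nat_add (CantorSeries.firstIndex α)
  have e2 := hsr.sum_add_tsum_nat_add (CantorSeries.firstIndex α + 1)
  rw [Finset.sum_eq_zero fun j hj => by
    rw [CantorSeries.eq_zero_of_lt_firstIndex (Finset.mem_range.1 hj), zero_mul], zero_add] at e1
  rw [Finset.sum_eq_zero fun i hi => by
    rw [hd0 i (Nat.lt_succ_iff.1 (Finset.mem_range.1 hi)), zero_mul], zero_add] at e2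
  rw [hdim, e1, e2]
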